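/- Let $q\in\mathbb C^\times$, let $\sqrt q$ be one of its square roots, and put $\delta=-q-q^{-1}$. **The algebra.** For odd $m,n$ an affine diagram with $m$ bottom and $n$ top points is a homotopy class (relative to the boundary) of systems of pairwise disjoint arcs on a cylinder that join, in pairs, $m$ marked points on the bottom circle and $n$ marked points on the top circle. If $\alpha$ has $m$ bottom points and $\beta$ has $m$ top points, gluing the bottom of $\alpha$ to the top of $\beta$ and removing the resulting closed loops, $m(\alpha,\beta)$ in number, gives a diagram $\alpha\circ\beta$; put $\alpha\beta=\delta^{m(\alpha,\beta)}\,\alpha\circ\beta$. The algebra $\mathbf T_3(\delta)$ is the $\mathbb C$-vector space with basis the diagrams with $3$ bottom and $3$ top points, with this multiplication extended bilinearly. Let $\mathcal Z$ be its centre and let $\mathcal V_3$ be the affine variety with coordinate ring $\mathcal Z$; its points are the maximal ideals of $\mathcal Z$. **The map $\Psi$.** For $k\in\{1,3\}$ let $C_k$ be the quotient of the span of the diagrams with $k$ bottom and $3$ top points by the span of those with fewer than $k$ arcs joining bottom to top. It is a left $\mathbf T_3(\delta)$-module and a right $\mathbb C[x,x^{-1}]$-module, $x$ acting by right multiplication with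 the twist $\tau_k$ (the diagram joining the bottom point $i$ to the top point $i+1$ for $i<k$, and the bottom point $k$ to the top point $1$ around the cylinder). Each $f\in\mathcal Z$ acts on $C_k$ as a unique Laurent polynomial $f_k\in\mathbb C[x,x^{-1}]$. Let $S_1=S_3=\mathbb C^\times$ and let $$\Psi: S_3\sqcup S_1\to\mathcal V_3$$ send $z\in S_k$ to the point given by the maximal ideal $\{f\in\mathcal Z : f_k(z)=0\}$. **Proposition.** Let $z_1=\sqrt q$, $z_2=-\sqrt q$, $z_3=1/\sqrt q$, $z_4=-1/\sqrt q$, regarded as points of $S_3$, and let $w_i=z_i^3$, regarded as points of $S_1$ ($i=1,2,3,4$). Then $\Psi(z_i)=\Psi(w_i)$ for $i=1,2,3,4$, and $\Psi$ maps $$\bigl(S_3\setminus\{z_1,z_2,z_3,z_4\}\bigr)\sqcup\bigl(S_1\setminus\{w_1,w_2,w_3,w_4\}\bigr)$$ bijectively onto $\mathcal V_3\setminus\{\Psi(z_1),\Psi(z_2),\Psi(z_3),\Psi(z_4)\}$. (The points $z_i$, $w_i$, $\Psi(z_i)$ need not be distinct for special $q$.) -/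

import Mathlib

open scoped LaurentPolynomial

set_option linter.unusedSectionVars false

namespace AffineTL

/-!
Affine Temperley-Lieb diagrams for odd numbers of marked points.

A diagram on the cylinder is described on its universal cover, the strip. The marked points of the
bottom circle lift to `ℤ` (the points `1, …, m` of the cut-open cylinder together with their
translates by multiples of `m`), those of the top circle lift to `ℤ` with period `n`. A homotopy
class of systems of disjoint arcs is a perfect matching of the lifted points that is invariant under
the deck transformation and noncrossing. If `m` and `n` are odd then at least one arc joins the
bottom to the top, so there is no room for circles that go around the cylinder; this is why no such
circles are recorded, and why the definitions below are meant for odd `m` and `n` only.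
-/

/-- Lifted marked points: `inl i` on the bottom line, `inr j` on the top line of the strip. -/
abbrev Pt := ℤ ⊕ ℤ

/-- The deck transformation: one turn around the cylinder. -/
def shift (m n : ℕ) : Pt → Pt
  | .inl i => .inl (i + m)
  | .inr j => .inr (j + n)

/-- The order of the boundary points of the strip: along the bottom from left to right, then along
the top from right to left. -/
def Before : Pt → Pt → Prop
  | .inl i, .inl j => i < j
  | .inl _, .inr _ => True
  | .inr i, .inr j => j < i
  | .inr _, .inl _ => False

/-- An affine diagram with `m` points on the bottom and `n` points on the top (`m`, `n` odd).
`arc p` is the other end of the arc that starts at `p`. -/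
@[ext]
structure AffineDiagram (m n : ℕ) where
  arc : Pt → Pt
  arc_arc : ∀ p, arc (arc p) = p
  arc_ne : ∀ p, arc p ≠ p
  arc_shift : ∀ p, arc (shift m n p) = shift m n (arc p)
  noncrossing : ∀ p r, ¬ (Before p r ∧ Before r (arc p) ∧ Before (arc p) (arc r))

/-- Points of two glued strips: `inl p` is a point of the outer boundary, `inr j` is a point of the
line along which they are glued. -/
abbrev GPt := Pt ⊕ ℤ

/-- Points of the lower diagram as points of the glued strip. -/
def lower : Pt → GPt
  | .inl i => .inl (.inl i)
  | .inr j => .inr j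

/-- Points of the upper diagram as points of the glued strip. -/
def upper : Pt → GPt
  | .inl i => .inr i
  | .inr j => .inl (.inr j)

/-- The deck transformation of the glued strip. -/
def gshift (k m n : ℕ) : GPt → GPt
  | .inl p => .inl (shift k n p)
  | .inr j => .inr (j + m)

section Compose

variable {k m n : ℕ}

/-- `u` and `v` are the ends of an arc of `α` (upper) or of `β` (lower). -/
def Joined (α : AffineDiagram m n) (β : AffineDiagram k m) (u v : GPt) : Prop :=
  (∃ p, u = upper p ∧ v = upper (α.arc p)) ∨ (∃ p, u = lower p ∧ v = lower (β.arc p))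

/-- `u` and `v` lie on the same curve of the glued strip. -/
def Linked (α : AffineDiagram m n) (β : AffineDiagram k m) : GPt → GPt → Prop :=
  Relation.EqvGen (Joined α β)

/-- As `Joined`, but points that lie over the same point of the cylinder are identified. -/
def JoinedOnCylinder (α : AffineDiagram m n) (β : AffineDiagram k m) (u v : GPt) : Prop :=
  Joined α β u v ∨ v = gshift k m n u

/-- `m(α, β)`: the number of curves of the glued cylinder that do not reach its boundary. -/
noncomputable def loops (α : AffineDiagram m n) (β : AffineDiagram k m) : ℕ :=
  Nat.card {c : Quot (JoinedOnCylinder α β) // ∀ p : Pt, c ≠ Quot.mk _ (.inl p)}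

theorem lower_injective : Function.Injective lower := by
  rintro (i | i) (j | j) h <;> simp_all [lower]

theorem upper_injective : Function.Injective upper := by
  rintro (i | i) (j | j) h <;> simp_all [upper]

theorem upper_shift (p : Pt) : upper (shift m n p) = gshift k m n (upper p) := by
  rcases p with p | p <;> rfl

theorem lower_shift (p : Pt) : lower (shift k m p) = gshift k m n (lower p) := by
  rcases p with p | p <;> rfl

theorem Joined.symm {α : AffineDiagram m n} {β : AffineDiagram k m} {u v : GPt}
    (h : Joined α β u v) : Joined α β v u := by
  rcases h with ⟨p, rfl, rfl⟩ | ⟨p, rfl, rfl⟩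
  · exact Or.inl ⟨α.arc p, rfl, by rw [α.arc_arc]⟩
  · exact Or.inr ⟨β.arc p, rfl, by rw [β.arc_arc]⟩

theorem Joined.shift {α : AffineDiagram m n} {β : AffineDiagram k m} {u v : GPt}
    (h : Joined α β u v) : Joined α β (gshift k m n u) (gshift k m n v) := by
  rcases h with ⟨p, rfl, rfl⟩ | ⟨p, rfl, rfl⟩
  · exact Or.inl ⟨AffineTL.shift m n p, by rw [upper_shift], by rw [α.arc_shift, upper_shift]⟩
  · exact Or.inr ⟨AffineTL.shift k m p, by rw [lower_shift], by rw [β.arc_shift, lower_shift]⟩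

theorem Linked.shift {α : AffineDiagram m n} {β : AffineDiagram k m} {u v : GPt}
    (h : Linked α β u v) : Linked α β (gshift k m n u) (gshift k m n v) := by
  induction h with
  | rel x y h => exact .rel _ _ h.shift
  | refl x => exact .refl _
  | symm x y _ ih => exact .symm _ _ ih
  | trans x y z _ _ ih1 ih2 => exact .trans _ _ _ ih1 ih2

/- half-edges: `inl` is a point of the lower diagram, `inr` is a point of the upper diagram -/

def toG : Pt ⊕ Pt → GPt := Sum.elim lower upper

def glue : Pt ⊕ Pt → Pt ⊕ Pt
  | .inl (.inl i) => .inl (.inl i)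
  | .inl (.inr j) => .inr (.inl j)
  | .inr (.inl j) => .inl (.inr j)
  | .inr (.inr i) => .inr (.inr i)

def along (α : AffineDiagram m n) (β : AffineDiagram k m) : Pt ⊕ Pt → Pt ⊕ Pt :=
  Sum.map β.arc α.arc

def walk (α : AffineDiagram m n) (β : AffineDiagram k m) (h : Pt ⊕ Pt) : Pt ⊕ Pt :=
  along α β (glue h)

def hshift (k m n : ℕ) : Pt ⊕ Pt → Pt ⊕ Pt := Sum.map (shift k m) (shift m n)

def outer : Pt → Pt ⊕ Pt
  | .inl i => .inl (.inl i)
  | .inr j => .inr (.inr j)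

theorem glue_glue (h : Pt ⊕ Pt) : glue (glue h) = h := by
  rcases h with (h | h) | (h | h) <;> rfl

theorem toG_glue (h : Pt ⊕ Pt) : toG (glue h) = toG h := by
  rcases h with (h | h) | (h | h) <;> rfl

theorem toG_eq_iff {h h2 : Pt ⊕ Pt} (e : toG h = toG h2) : h = h2 ∨ h = glue h2 := by
  rcases h with (h | h) | (h | h) <;> rcases h2 with (h2 | h2) | (h2 | h2) <;>
    simp_all [toG, glue, lower, upper]

theorem along_along (α : AffineDiagram m n) (β : AffineDiagram k m) (h : Pt ⊕ Pt) :
    along α β (along α β h) = h := by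
  rcases h with h | h <;> simp [along, α.arc_arc, β.arc_arc]

theorem along_ne (α : AffineDiagram m n) (β : AffineDiagram k m) (h : Pt ⊕ Pt) :
    along α β h ≠ h := by
  rcases h with h | h <;> simp [along, α.arc_ne, β.arc_ne]

theorem joined_iff (α : AffineDiagram m n) (β : AffineDiagram k m) (u v : GPt) :
    Joined α β u v ↔ ∃ h, u = toG h ∧ v = toG (along α β h) := by
  constructor
  · rintro (⟨p, rfl, rfl⟩ | ⟨p, rfl, rfl⟩)
    · exact ⟨.inr p, rfl, rfl⟩
    · exact ⟨.inl p, rfl, rfl⟩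
  · rintro ⟨h | h, rfl, rfl⟩
    · exact Or.inr ⟨h, rfl, rfl⟩
    · exact Or.inl ⟨h, rfl, rfl⟩

theorem glue_hshift (h : Pt ⊕ Pt) : glue (hshift k m n h) = hshift k m n (glue h) := by
  rcases h with (h | h) | (h | h) <;> rfl

theorem walk_hshift (α : AffineDiagram m n) (β : AffineDiagram k m) (h : Pt ⊕ Pt) :
    walk α β (hshift k m n h) = hshift k m n (walk α β h) := by
  rw [walk, glue_hshift, walk]
  rcases glue h with h | h <;> simp [along, hshift, α.arc_shift, β.arc_shift]

theorem walk_injective (α : AffineDiagram m n) (β : AffineDiagram k m) :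
    Function.Injective (walk α β) := by
  intro x y h
  have h2 := congrArg (along α β) h
  rw [walk, walk, along_along, along_along] at h2
  simpa [glue_glue] using congrArg glue h2

theorem hshift_injective : Function.Injective (hshift k m n) := by
  rintro ((h | h) | (h | h)) ((h2 | h2) | (h2 | h2)) e <;> simp_all [hshift, shift]

/-- residue classes of half-edges under the deck transformation -/
def residue (k m n : ℕ) : Pt ⊕ Pt → (ZMod k ⊕ ZMod m) ⊕ (ZMod m ⊕ ZMod n) :=
  Sum.map (Sum.map (fun i => (i : ZMod k)) (fun i => (i : ZMod m)))
    (Sum.map (fun i => (i : ZMod m)) (fun i => (i : ZMod n)))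

theorem exists_shift_of_residue_eq {x y : Pt ⊕ Pt} (h : residue k m n x = residue k m n y) :
    ∃ t : ℕ, x = (hshift k m n)^[t] y ∨ y = (hshift k m n)^[t] x := by
  have key : ∀ (t : ℕ), (∀ i, (hshift k m n)^[t] (.inl (.inl i)) = .inl (.inl (i + t * k))) ∧
      (∀ i, (hshift k m n)^[t] (.inl (.inr i)) = .inl (.inr (i + t * m))) ∧
      (∀ i, (hshift k m n)^[t] (.inr (.inl i)) = .inr (.inl (i + t * m))) ∧
      (∀ i, (hshift k m n)^[t] (.inr (.inr i)) = .inr (.inr (i + t * n))) := by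
    intro t
    induction t with
    | zero => simp
    | succ t ih =>
      obtain ⟨h1, h2, h3, h4⟩ := ih
      refine ⟨?_, ?_, ?_, ?_⟩ <;> intro i <;> rw [Function.iterate_succ_apply'] <;>
        simp only [h1, h2, h3, h4] <;> simp [hshift, shift] <;> ring
  have aux : ∀ (l : ℕ) (i j : ℤ), (i : ZMod l) = (j : ZMod l) →
      ∃ t : ℕ, i = j + t * l ∨ j = i + t * l := by
    intro l i j h
    rw [ZMod.intCast_eq_intCast_iff_dvd_sub] at h
    obtain ⟨c, hc⟩ := h
    obtain ⟨t, rfl | rfl⟩ := c.eq_nat_or_neg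
    · exact ⟨t, Or.inr (by linarith)⟩
    · exact ⟨t, Or.inl (by linarith)⟩
  rcases x with (x | x) | (x | x) <;> rcases y with (y | y) | (y | y) <;>
    simp [residue] at h <;> obtain ⟨t, ht⟩ := aux _ _ _ h <;> refine ⟨t, ?_⟩ <;>
    simpa [key] using ht

theorem glue_iterate_hshift (t : ℕ) (h : Pt ⊕ Pt) :
    glue ((hshift k m n)^[t] h) = (hshift k m n)^[t] (glue h) := by
  induction t generalizing h with
  | zero => rfl
  | succ t ih => rw [Function.iterate_succ_apply, ih, glue_hshift, Function.iterate_succ_apply]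

theorem walk_returns [NeZero k] [NeZero m] [NeZero n] (α : AffineDiagram m n)
    (β : AffineDiagram k m) (o : Pt ⊕ Pt) (ho : glue o = o) :
    ∃ r, 0 < r ∧ glue ((walk α β)^[r] o) = (walk α β)^[r] o := by
  have hfin : ¬ Function.Injective (fun i : ℕ => residue k m n ((walk α β)^[i] o)) :=
    not_injective_infinite_finite _
  have comm : Function.Commute (hshift k m n) (walk α β) :=
    fun h => (walk_hshift α β h).symm
  rw [Function.not_injective_iff] at hfin
  obtain ⟨i, j, hij, hne⟩ := hfin
  have main : ∀ i j : ℕ, i < j → residue k m n ((walk α β)^[i] o) =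
      residue k m n ((walk α β)^[j] o) →
      ∃ r, 0 < r ∧ glue ((walk α β)^[r] o) = (walk α β)^[r] o := by
    intro i j hlt h
    obtain ⟨d, rfl⟩ := Nat.exists_eq_add_of_lt hlt
    refine ⟨d + 1, Nat.succ_pos _, ?_⟩
    have e : (walk α β)^[i + d + 1] o = (walk α β)^[i] ((walk α β)^[d + 1] o) := by
      rw [← Function.iterate_add_apply, add_assoc]
    obtain ⟨t, ht | ht⟩ := exists_shift_of_residue_eq h
    · rw [e, (comm.iterate_iterate t i) _] at ht
      have h3 := (walk_injective α β).iterate i ht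
      apply (hshift_injective (k := k) (m := m) (n := n)).iterate t
      rw [← glue_iterate_hshift, ← h3, ho]
    · rw [e, (comm.iterate_iterate t i) _] at ht
      have h3 := (walk_injective α β).iterate i ht
      rw [h3, glue_iterate_hshift, ho]
  rcases lt_or_gt_of_ne hne with h | h
  · exact main i j h hij
  · exact main j i h hij.symm

theorem glue_eq_self {h : Pt ⊕ Pt} (e : glue h = h) : ∃ p, h = outer p := by
  rcases h with (h | h) | (h | h) <;> simp [glue] at e
  · exact ⟨.inl h, rfl⟩
  · exact ⟨.inr h, rfl⟩

theorem toG_outer (p : Pt) : toG (outer p) = .inl p := by rcases p with p | p <;> rfl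

theorem glue_outer (p : Pt) : glue (outer p) = outer p := by rcases p with p | p <;> rfl

/-- The curve of the glued diagram that starts at an outer point is a finite set of points, closed
under the arcs, that meets the outer boundary in exactly two points. -/
theorem exists_path [NeZero k] [NeZero m] [NeZero n] (α : AffineDiagram m n)
    (β : AffineDiagram k m) (p : Pt) :
    ∃ (A : Finset GPt) (p2 : Pt), p2 ≠ p ∧ (∀ c, .inl c ∈ A ↔ c = p ∨ c = p2) ∧
      (∀ u ∈ A, Linked α β (.inl p) u) ∧ (∀ u v, u ∈ A → Joined α β u v → v ∈ A) := by
  classical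
  have hret := walk_returns α β (outer p) (glue_outer p)
  set r := Nat.find hret with hr
  obtain ⟨hr0, hrg⟩ := Nat.find_spec hret
  rw [← hr] at hr0 hrg
  have hmin : ∀ i, i < r → glue ((walk α β)^[i] (outer p)) = (walk α β)^[i] (outer p) → i = 0 := by
    intro i hi h
    by_contra h0
    exact Nat.find_min hret hi ⟨Nat.pos_of_ne_zero h0, h⟩
  set w : ℕ → Pt ⊕ Pt := fun i => (walk α β)^[i] (outer p) with hw
  have hws : ∀ i, w (i + 1) = along α β (glue (w i)) := fun i => by
    simp only [hw, Function.iterate_succ_apply']; rfl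
  have hw0 : w 0 = outer p := rfl
  have hrg : glue (w r) = w r := hrg
  have hmin : ∀ i, i < r → glue (w i) = w i → i = 0 := hmin
  obtain ⟨p2, hp2⟩ := glue_eq_self hrg
  refine ⟨(Finset.range (r + 1)).image (fun i => toG (w i)), p2, ?_, ?_, ?_, ?_⟩
  · rintro rfl
    have hrev : ∀ i, i ≤ r → w (r - i) = glue (w i) := by
      intro i
      induction i with
      | zero => intro _; rw [Nat.sub_zero, hw0, glue_outer, hp2]
      | succ i ih =>
        intro hi
        have h1 := ih (by omega)
        have h2 : r - i = (r - (i + 1)) + 1 := by omega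
        rw [h2, hws] at h1
        have h3 := congrArg (along α β) h1
        rw [along_along, ← hws] at h3
        rw [← h3, glue_glue]
    rcases Nat.even_or_odd' r with ⟨i, hi | hi⟩
    · have := hrev i (by omega)
      rw [show r - i = i by omega] at this
      have := hmin i (by omega) this.symm
      omega
    · have := hrev i (by omega)
      rw [show r - i = i + 1 by omega, hws] at this
      exact along_ne _ _ _ this
  · intro c
    simp only [Finset.mem_image, Finset.mem_range]
    constructor
    · rintro ⟨i, hi, e⟩
      rw [← toG_outer c] at e
      have e2 : w i = outer c := by
        rcases toG_eq_iff e with e | e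
        · exact e
        · rw [e, glue_outer]
      rcases Nat.lt_or_ge i r with h | h
      · have := hmin i h (by rw [e2, glue_outer])
        subst this
        left
        have := congrArg toG (e2.symm.trans hw0)
        rw [toG_outer, toG_outer] at this
        simpa using this
      · obtain rfl : i = r := by omega
        right
        have := congrArg toG (e2.symm.trans hp2)
        rw [toG_outer, toG_outer] at this
        simpa using this
    · rintro (rfl | rfl)
      · exact ⟨0, by omega, by rw [hw0, toG_outer]⟩
      · exact ⟨r, by omega, by rw [hp2, toG_outer]⟩
  · intro u hu
    simp only [Finset.mem_image, Finset.mem_range] at hu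
    obtain ⟨i, hi, rfl⟩ := hu
    clear hi
    induction i with
    | zero => rw [hw0, toG_outer]; exact .refl _
    | succ i ih =>
      refine .trans _ _ _ ih (.rel _ _ ?_)
      rw [joined_iff]
      exact ⟨glue (w i), (toG_glue _).symm, by rw [hws]⟩
  · intro u v hu huv
    simp only [Finset.mem_image, Finset.mem_range] at hu ⊢
    obtain ⟨i, hi, rfl⟩ := hu
    rw [joined_iff] at huv
    obtain ⟨h, hh, rfl⟩ := huv
    have back : ∀ i, i < r + 1 → h = w i → ∃ a < r + 1, toG (w a) = toG (along α β h) := by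
      intro i hi e
      rcases i with _ | i
      · exact ⟨1, by omega, by rw [hws, hw0, glue_outer, e, hw0]⟩
      · refine ⟨i, by omega, ?_⟩
        rw [e, hws, along_along, toG_glue]
    rcases toG_eq_iff hh.symm with e | e
    · exact back i hi e
    · rcases Nat.lt_or_ge i r with h4 | h4
      · exact ⟨i + 1, by omega, by rw [hws, e]⟩
      · obtain rfl : i = r := by omega
        exact back _ hi (e.trans hrg)

theorem mem_of_linked {α : AffineDiagram m n} {β : AffineDiagram k m} {A : Set GPt}
    (hA : ∀ u v, u ∈ A → Joined α β u v → v ∈ A) {u v : GPt} (h : Linked α β u v) :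
    u ∈ A ↔ v ∈ A := by
  induction h with
  | rel x y h => exact ⟨fun hx => hA _ _ hx h, fun hy => hA _ _ hy h.symm⟩
  | refl x => exact Iff.rfl
  | symm x y _ ih => exact ih.symm
  | trans x y z _ _ ih1 ih2 => exact ih1.trans ih2

theorem existsUnique_partner [NeZero k] [NeZero m] [NeZero n] (α : AffineDiagram m n)
    (β : AffineDiagram k m) (p : Pt) :
    ∃! r : Pt, r ≠ p ∧ Linked α β (.inl p) (.inl r) := by
  obtain ⟨A, p2, hne, hout, hlink, hcl⟩ := exists_path α β p
  refine ⟨p2, ⟨hne, hlink _ ((hout _).2 (Or.inr rfl))⟩, ?_⟩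
  rintro r ⟨hr, hl⟩
  have := (mem_of_linked (A := (A : Set GPt)) hcl hl).1 ((hout p).2 (Or.inl rfl))
  rcases (hout r).1 this with h | h
  · exact absurd h hr
  · exact h

/-- The other end on the outer boundary of the curve that starts at the outer point `p`. -/
noncomputable def partner [NeZero k] [NeZero m] [NeZero n] (α : AffineDiagram m n)
    (β : AffineDiagram k m) (p : Pt) : Pt := (existsUnique_partner α β p).choose

/- parity of the number of points of an arc to the left of a point on the same level -/

def leftOf : Pt → Pt → ZMod 2
  | .inl i, .inl j => if i < j then 1 else 0
  | .inr i, .inr j => if i < j then 1 else 0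
  | _, _ => 0

def gleftOf : GPt → GPt → ZMod 2
  | .inl p, .inl r => leftOf p r
  | .inr i, .inr j => if i < j then 1 else 0
  | _, _ => 0

theorem parity_of_noncrossing (f : Pt → Pt)
    (hf : ∀ p r, ¬ (Before p r ∧ Before r (f p) ∧ Before (f p) (f r)))
    (hff : ∀ p, f (f p) = p) (hne : ∀ p, f p ≠ p) (p r : Pt) (h1 : r ≠ p) (h2 : r ≠ f p) :
    leftOf p r + leftOf p (f r) + (leftOf (f p) r + leftOf (f p) (f r)) = 0 := by
  have a1 := hf p r
  have a2 := hf p (f r)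
  have a3 := hf (f p) r
  have a4 := hf (f p) (f r)
  have b1 := hf r p
  have b2 := hf r (f p)
  have b3 := hf (f r) p
  have b4 := hf (f r) (f p)
  have c1 : f r ≠ p := fun h => h2 (by rw [← h, hff])
  have c2 : f r ≠ f p := fun h => h1 (by rw [← hff r, h, hff])
  have c3 := hne p
  have c4 := hne r
  simp only [hff] at *
  generalize f p = p2 at *
  generalize f r = r2 at *
  clear hf hff hne
  rcases p with p | p <;> rcases r with r | r <;> rcases p2 with p2 | p2 <;>
    rcases r2 with r2 | r2 <;> simp only [Before, leftOf, ne_eq, Sum.inl.injEq, Sum.inr.injEq,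
      true_and, and_true, false_and, and_false, not_false_iff, reduceCtorEq] at * <;>
    (try split_ifs) <;> first | omega | decide

theorem noncrossing_of_parity {p r p2 r2 : Pt}
    (h : leftOf p r + leftOf p r2 + (leftOf p2 r + leftOf p2 r2) = 0) :
    ¬ (Before p r ∧ Before r p2 ∧ Before p2 r2) := by
  rcases p with p | p <;> rcases r with r | r <;> rcases p2 with p2 | p2 <;>
    rcases r2 with r2 | r2 <;> simp only [Before, leftOf] at * <;>
    (try split_ifs at h) <;> first | omega | (exfalso; revert h; decide) | simp


theorem partner_spec [NeZero k] [NeZero m] [NeZero n] (α : AffineDiagram m n)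
    (β : AffineDiagram k m) (p : Pt) :
    partner α β p ≠ p ∧ Linked α β (.inl p) (.inl (partner α β p)) :=
  (existsUnique_partner α β p).choose_spec.1

theorem partner_eq [NeZero k] [NeZero m] [NeZero n] {α : AffineDiagram m n}
    {β : AffineDiagram k m} {p r : Pt} (h : r ≠ p) (hl : Linked α β (.inl p) (.inl r)) :
    partner α β p = r :=
  (existsUnique_partner α β p).unique (partner_spec α β p) ⟨h, hl⟩

theorem linked_outer_iff [NeZero k] [NeZero m] [NeZero n] {α : AffineDiagram m n}
    {β : AffineDiagram k m} {p r : Pt} :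
    Linked α β (.inl p) (.inl r) ↔ r = p ∨ r = partner α β p := by
  constructor
  · intro h
    by_cases e : r = p
    · exact Or.inl e
    · exact Or.inr (partner_eq e h).symm
  · rintro (rfl | rfl)
    · exact .refl _
    · exact (partner_spec α β p).2

theorem sum_gleftOf_joined (α : AffineDiagram m n) (β : AffineDiagram k m) (A : Finset GPt)
    (hA : ∀ u v, u ∈ A → Joined α β u v → v ∈ A) {v w : GPt} (hv : v ∉ A)
    (h : Joined α β v w) : ∑ a ∈ A, gleftOf a v = ∑ a ∈ A, gleftOf a w := by
  have two : ∀ x y : ZMod 2, x + y = 0 → x = y := by decide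
  apply two
  rw [← Finset.sum_add_distrib]
  have main : ∀ {m n : ℕ} (δ : AffineDiagram m n) (e : Pt → GPt), Function.Injective e →
      (∀ p r, gleftOf (e p) (e r) = leftOf p r) →
      (∀ a, (∀ p, a ≠ e p) → ∀ r, gleftOf a (e r) = 0) →
      (∀ p, e p ∈ A → e (δ.arc p) ∈ A) → (∀ r, e r ∉ A →
      ∑ a ∈ A, (gleftOf a (e r) + gleftOf a (e (δ.arc r))) = 0) := by
    intro m n δ e he h1 h2 h3 r hr
    classical
    refine Finset.sum_involution
      (fun a _ => if h : ∃ p, a = e p then e (δ.arc h.choose) else a) ?_ ?_ ?_ ?_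
    · intro a ha
      by_cases h : ∃ p, a = e p
      · simp only [h, dif_pos]
        obtain ⟨p, hp⟩ : ∃ p, p = h.choose := ⟨_, rfl⟩
        have hp2 := h.choose_spec
        rw [← hp] at hp2 ⊢
        subst hp2
        simp only [h1]
        refine parity_of_noncrossing δ.arc δ.noncrossing δ.arc_arc δ.arc_ne p r ?_ ?_
        · rintro rfl; exact hr ha
        · rintro rfl; exact hr (h3 _ ha)
      · simp only [h, dif_neg, not_false_iff]
        rw [h2 a (fun p hp => h ⟨p, hp⟩), h2 a (fun p hp => h ⟨p, hp⟩)]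
        decide
    · intro a ha hne
      by_cases h : ∃ p, a = e p
      · simp only [h, dif_pos]
        intro heq
        have := heq.trans h.choose_spec
        exact δ.arc_ne _ (he this)
      · exfalso
        apply hne
        rw [h2 a (fun p hp => h ⟨p, hp⟩), h2 a (fun p hp => h ⟨p, hp⟩), add_zero]
    · intro a ha
      by_cases h : ∃ p, a = e p
      · simp only [h, dif_pos]
        apply h3
        rw [← h.choose_spec]
        exact ha
      · simpa only [h, dif_neg, not_false_iff] using ha
    · intro a ha
      by_cases h : ∃ p, a = e p
      · simp only [h, dif_pos]
        have h4 : ∃ p, e (δ.arc h.choose) = e p := ⟨_, rfl⟩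
        have h5 := he h4.choose_spec
        simp only [h4, dif_pos]
        rw [← h5, δ.arc_arc, ← h.choose_spec]
      · simp only [h, dif_neg, not_false_iff]
  rcases h with ⟨p, rfl, rfl⟩ | ⟨p, rfl, rfl⟩
  · refine main α upper upper_injective ?_ ?_ (fun p hp => hA _ _ hp (Or.inl ⟨p, rfl, rfl⟩)) p hv
    · rintro (p | p) (r | r) <;> rfl
    · rintro ((a | a) | a) ha (r | r) <;> first | rfl | exact absurd rfl (ha (.inl a)) |
        exact absurd rfl (ha (.inr a))
  · refine main β lower lower_injective ?_ ?_ (fun p hp => hA _ _ hp (Or.inr ⟨p, rfl, rfl⟩)) p hv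
    · rintro (p | p) (r | r) <;> rfl
    · rintro ((a | a) | a) ha (r | r) <;> first | rfl | exact absurd rfl (ha (.inl a)) |
        exact absurd rfl (ha (.inr a))

theorem shift_injective : Function.Injective (shift m n) := by
  rintro (i | i) (j | j) h <;> simp_all [shift]

theorem before_irrefl (p : Pt) : ¬ Before p p := by
  rcases p with p | p <;> simp [Before]

theorem partner_noncrossing [NeZero k] [NeZero m] [NeZero n] (α : AffineDiagram m n)
    (β : AffineDiagram k m) (p r : Pt) : ¬ (Before p r ∧ Before r (partner α β p) ∧
      Before (partner α β p) (partner α β r)) := by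
  by_cases h1 : r = p
  · subst h1
    exact fun h => before_irrefl _ h.1
  by_cases h2 : r = partner α β p
  · rintro ⟨-, h, -⟩
    rw [h2] at h
    exact before_irrefl _ h
  classical
  obtain ⟨A, p2, hne, hout, hlink, hcl⟩ := exists_path α β p
  have hp2 : partner α β p = p2 := partner_eq hne (hlink _ ((hout _).2 (Or.inr rfl)))
  rw [hp2] at h2 ⊢
  have hr : .inl r ∉ A := fun h => ((hout r).1 h).elim h1 h2
  have hs : ∀ u v, Linked α β u v → u ∉ A →
      ∑ a ∈ A, gleftOf a u = ∑ a ∈ A, gleftOf a v := by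
    intro u v h
    induction h with
    | rel x y h => exact fun hx => sum_gleftOf_joined α β A hcl hx h
    | refl x => exact fun _ => rfl
    | symm x y h ih =>
      exact fun hy => (ih (fun hx =>
        hy ((mem_of_linked (A := (A : Set GPt)) hcl h).1 hx))).symm
    | trans x y z h _ ih1 ih2 =>
      exact fun hx => (ih1 hx).trans (ih2 (fun hy =>
        hx ((mem_of_linked (A := (A : Set GPt)) hcl h).2 hy)))
  have hsum : ∀ c : Pt, ∑ a ∈ A, gleftOf a (.inl c) = leftOf p c + leftOf p2 c := by
    intro c
    have hsub : ({.inl p, .inl p2} : Finset GPt) ⊆ A := by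
      intro u hu
      simp only [Finset.mem_insert, Finset.mem_singleton] at hu
      rcases hu with rfl | rfl
      · exact (hout _).2 (Or.inl rfl)
      · exact (hout _).2 (Or.inr rfl)
    rw [← Finset.sum_subset hsub, Finset.sum_pair]
    · rfl
    · simpa using hne.symm
    · rintro (a | a) ha hna
      · rcases (hout a).1 ha with rfl | rfl <;> simp at hna
      · rfl
  have h3 := hs _ _ (partner_spec α β r).2 hr
  rw [hsum, hsum] at h3
  apply noncrossing_of_parity
  have two : ∀ x y z w : ZMod 2, x + y = z + w → x + z + (y + w) = 0 := by decide
  exact two _ _ _ _ h3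

/-- `α ∘ β`: the bottom of `α` is glued to the top of `β`, and loops are removed. -/
noncomputable def AffineDiagram.comp [NeZero k] [NeZero m] [NeZero n] (α : AffineDiagram m n)
    (β : AffineDiagram k m) : AffineDiagram k n where
  arc := partner α β
  arc_arc p := partner_eq (partner_spec α β p).1.symm (.symm _ _ (partner_spec α β p).2)
  arc_ne p := (partner_spec α β p).1
  arc_shift p := partner_eq (fun h => (partner_spec α β p).1 (shift_injective h))
    (partner_spec α β p).2.shift
  noncrossing := partner_noncrossing α β

end Compose

/- gluing in two stages -/

section Stages

variable {U V W : Type} (r₁ : U → U → Prop) (r₂ : W → W → Prop) (i : U → V) (j : W → V)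

def Total (x y : V) : Prop :=
  (∃ a b, r₁ a b ∧ x = i a ∧ y = i b) ∨ (∃ a b, r₂ a b ∧ x = j a ∧ y = j b)

variable {r₁ r₂ i j} {rV : V → V → Prop}

theorem Total.eqvGen_left {a b : U} (h : Relation.EqvGen r₁ a b) :
    Relation.EqvGen (Total r₁ r₂ i j) (i a) (i b) := by
  induction h with
  | rel x y h => exact .rel _ _ (Or.inl ⟨x, y, h, rfl, rfl⟩)
  | refl x => exact .refl _
  | symm x y _ ih => exact .symm _ _ ih
  | trans x y z _ _ ih1 ih2 => exact .trans _ _ _ ih1 ih2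

/-- `W` is the graph in which the first stage has been replaced by the induced relation. -/
structure Staged (r₁ : U → U → Prop) (r₂ rW : W → W → Prop) (i : U → V) (j : W → V) : Prop where
  i_inj : Function.Injective i
  j_inj : Function.Injective j
  cover : ∀ v, (∃ u, v = i u) ∨ (∃ w, v = j w)
  sub : ∀ a b, r₂ a b → rW a b
  induced : ∀ u u2 w w2, Relation.EqvGen r₁ u u2 → i u = j w → i u2 = j w2 →
    Relation.EqvGen rW w w2
  sound : ∀ a b, rW a b → Relation.EqvGen (Total r₁ r₂ i j) (j a) (j b)

variable {rW : W → W → Prop}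

def Near (r₁ : U → U → Prop) (i : U → V) (j : W → V) (v : V) (w : W) : Prop :=
  v = j w ∨ ∃ u u2, v = i u ∧ Relation.EqvGen r₁ u u2 ∧ i u2 = j w

theorem Staged.near_unique (h : Staged r₁ r₂ rW i j) {v : V} {w w2 : W}
    (h1 : Near r₁ i j v w) (h2 : Near r₁ i j v w2) : Relation.EqvGen rW w w2 := by
  rcases h1 with rfl | ⟨u, u2, rfl, hu, e⟩
  · rcases h2 with h2 | ⟨u, u2, e1, hu, e⟩
    · rw [h.j_inj h2]; exact .refl _
    · exact h.induced _ _ _ _ hu e1.symm e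
  · rcases h2 with h2 | ⟨u', u2', e1, hu', e'⟩
    · exact h.induced _ _ _ _ (.symm _ _ hu) e h2
    · obtain rfl := h.i_inj e1
      exact h.induced _ _ _ _ (.trans _ _ _ (.symm _ _ hu) hu') e e'

abbrev Closed (r₁ : U → U → Prop) (i : U → V) (j : W → V) : Type :=
  {c : Quot r₁ // ∀ u w, i u = j w → c ≠ Quot.mk _ u}

theorem Staged.closed_of (h : Staged r₁ r₂ rW i j) (v : V) (hv : ¬ ∃ w, Near r₁ i j v w) :
    ∃ u, v = i u ∧ ∀ u2 w, i u2 = j w → Quot.mk r₁ u ≠ Quot.mk _ u2 := by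
  rcases h.cover v with ⟨u, rfl⟩ | ⟨w, rfl⟩
  · exact ⟨u, rfl, fun u2 w e hq => hv ⟨w, Or.inr ⟨u, u2, rfl, Quot.eqvGen_exact hq, e⟩⟩⟩
  · exact absurd ⟨w, Or.inl rfl⟩ hv

open Classical in
noncomputable def Staged.toSum (h : Staged r₁ r₂ rW i j) (v : V) : Quot rW ⊕ Closed r₁ i j :=
  if hv : ∃ w, Near r₁ i j v w then .inl (Quot.mk _ hv.choose)
  else .inr ⟨Quot.mk _ (h.closed_of v hv).choose, (h.closed_of v hv).choose_spec.2⟩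

theorem Staged.toSum_near (h : Staged r₁ r₂ rW i j) {v : V} {w : W} (hv : Near r₁ i j v w) :
    h.toSum v = .inl (Quot.mk _ w) := by
  have hex : ∃ w, Near r₁ i j v w := ⟨w, hv⟩
  rw [Staged.toSum, dif_pos hex]
  exact congrArg _ (Quot.eqvGen_sound (h.near_unique hex.choose_spec hv))

theorem Staged.toSum_closed (h : Staged r₁ r₂ rW i j) {u : U}
    (hu : ∀ u2 w, i u2 = j w → Quot.mk r₁ u ≠ Quot.mk _ u2) :
    h.toSum (i u) = .inr ⟨Quot.mk _ u, hu⟩ := by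
  have hex : ¬ ∃ w, Near r₁ i j (i u) w := by
    rintro ⟨w, e | ⟨u1, u2, e1, hq, e⟩⟩
    · exact hu u w e rfl
    · obtain rfl := h.i_inj e1
      exact hu u2 w e (Quot.eqvGen_sound hq)
  rw [Staged.toSum, dif_neg hex]
  congr 2
  exact (congrArg _ (h.i_inj (h.closed_of _ hex).choose_spec.1)).symm

theorem Staged.toSum_total (h : Staged r₁ r₂ rW i j) {x y : V} (hxy : Total r₁ r₂ i j x y) :
    h.toSum x = h.toSum y := by
  rcases hxy with ⟨a, b, hr, rfl, rfl⟩ | ⟨a, b, hr, rfl, rfl⟩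
  · have hq : Quot.mk r₁ a = Quot.mk r₁ b := Quot.sound hr
    by_cases hc : ∀ u2 w, i u2 = j w → Quot.mk r₁ a ≠ Quot.mk _ u2
    · rw [h.toSum_closed hc, h.toSum_closed (u := b) (by rwa [← hq])]
      congr 2
    · push Not at hc
      obtain ⟨u2, w, e, hc⟩ := hc
      rw [h.toSum_near (w := w) (Or.inr ⟨a, u2, rfl, Quot.eqvGen_exact hc, e⟩),
        h.toSum_near (w := w) (Or.inr ⟨b, u2, rfl, Quot.eqvGen_exact (hq.symm.trans hc), e⟩)]
  · rw [h.toSum_near (Or.inl rfl), h.toSum_near (Or.inl rfl), Quot.sound (h.sub _ _ hr)]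

theorem Staged.eqvGen_sound (h : Staged r₁ r₂ rW i j) {a b : W} (hab : Relation.EqvGen rW a b) :
    Relation.EqvGen (Total r₁ r₂ i j) (j a) (j b) := by
  induction hab with
  | rel x y hr => exact h.sound _ _ hr
  | refl x => exact .refl _
  | symm x y _ ih => exact .symm _ _ ih
  | trans x y z _ _ ih1 ih2 => exact .trans _ _ _ ih1 ih2

noncomputable def Staged.equiv (h : Staged r₁ r₂ rW i j) :
    Quot (Total r₁ r₂ i j) ≃ Quot rW ⊕ Closed r₁ i j where
  toFun := Quot.lift h.toSum (fun _ _ => h.toSum_total)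
  invFun := Sum.elim
    (Quot.lift (fun w => Quot.mk _ (j w)) (fun _ _ hr => Quot.eqvGen_sound (h.sound _ _ hr)))
    (fun c => Quot.lift (fun u => Quot.mk _ (i u))
      (fun _ _ hr => Quot.eqvGen_sound (Total.eqvGen_left (.rel _ _ hr))) c.1)
  left_inv := by
    rintro ⟨v⟩
    by_cases hv : ∃ w, Near r₁ i j v w
    · obtain ⟨w, hw⟩ := hv
      simp only [h.toSum_near hw, Sum.elim_inl]
      rcases hw with rfl | ⟨u, u2, rfl, hu, e⟩
      · rfl
      · refine (Quot.eqvGen_sound ?_).symm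
        rw [← e]
        exact Total.eqvGen_left hu
    · obtain ⟨u, rfl, hu⟩ := h.closed_of v hv
      simp only [h.toSum_closed hu, Sum.elim_inr]
  right_inv := by
    rintro (w | ⟨u, hu⟩)
    · induction w using Quot.ind with | _ w
      exact h.toSum_near (Or.inl rfl)
    · induction u using Quot.ind with | _ u
      exact h.toSum_closed hu

theorem Staged.eqvGen_iff (h : Staged r₁ r₂ rW i j) {a b : W} :
    Relation.EqvGen (Total r₁ r₂ i j) (j a) (j b) ↔ Relation.EqvGen rW a b := by
  refine ⟨fun hab => ?_, h.eqvGen_sound⟩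
  have := congrArg h.equiv (Quot.eqvGen_sound hab)
  have h2 : h.toSum (j a) = h.toSum (j b) := this
  rw [h.toSum_near (Or.inl rfl), h.toSum_near (Or.inl rfl)] at h2
  exact Quot.eqvGen_exact (Sum.inl_injective h2)

theorem Staged.card (h : Staged r₁ r₂ rW i j) [Finite (Quot r₁)] [Finite (Quot rW)]
    {O : Type} (o : O → W) :
    Nat.card {c : Quot (Total r₁ r₂ i j) // ∀ p, c ≠ Quot.mk _ (j (o p))} =
      Nat.card {c : Quot rW // ∀ p, c ≠ Quot.mk _ (o p)} + Nat.card (Closed r₁ i j) := by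
  rw [← Nat.card_sum]
  refine Nat.card_congr ?_
  have hmk : ∀ w, h.equiv (Quot.mk _ (j w)) = .inl (Quot.mk _ w) :=
    fun w => h.toSum_near (Or.inl rfl)
  refine (h.equiv.subtypeEquiv (q := fun s => ∀ p, s ≠ .inl (Quot.mk _ (o p))) ?_).trans
    ((Equiv.subtypeSum).trans (Equiv.sumCongr (Equiv.subtypeEquivRight ?_)
      (Equiv.subtypeUnivEquiv ?_)))
  · intro c
    refine forall_congr' fun p => not_congr ?_
    rw [← hmk, h.equiv.apply_eq_iff_eq]
  · intro c
    simp
  · intro c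
    simp

end Stages

section Assoc

variable {k l m n : ℕ}

theorem shift_surjective (p : Pt) : ∃ r, p = shift m n r := by
  rcases p with i | i
  · exact ⟨.inl (i - m), by simp [shift]⟩
  · exact ⟨.inr (i - n), by simp [shift]⟩

theorem gshift_surjective (u : GPt) : ∃ v, u = gshift k m n v := by
  rcases u with p | i
  · obtain ⟨r, rfl⟩ := shift_surjective (m := k) (n := n) p
    exact ⟨.inl r, rfl⟩
  · exact ⟨.inr (i - m), by simp [gshift]⟩

theorem gshift_injective : Function.Injective (gshift k m n) := by
  rintro (p | i) (r | j) h <;> simp only [gshift, Sum.inl.injEq, Sum.inr.injEq, reduceCtorEq] at h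
  · rw [shift_injective h]
  · congr 1; omega

theorem Joined.of_shift {α : AffineDiagram m n} {β : AffineDiagram k m} {u v : GPt}
    (h : Joined α β (gshift k m n u) (gshift k m n v)) : Joined α β u v := by
  rcases h with ⟨p, h1, h2⟩ | ⟨p, h1, h2⟩
  · obtain ⟨r, rfl⟩ := shift_surjective (m := m) (n := n) p
    rw [upper_shift (k := k)] at h1
    rw [α.arc_shift, upper_shift (k := k)] at h2
    exact Or.inl ⟨r, gshift_injective h1, gshift_injective h2⟩
  · obtain ⟨r, rfl⟩ := shift_surjective (m := k) (n := m) p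
    rw [lower_shift (n := n)] at h1
    rw [β.arc_shift, lower_shift (n := n)] at h2
    exact Or.inr ⟨r, gshift_injective h1, gshift_injective h2⟩

theorem Linked.of_shift {α : AffineDiagram m n} {β : AffineDiagram k m} {u v : GPt}
    (h : Linked α β (gshift k m n u) (gshift k m n v)) : Linked α β u v := by
  generalize hx : gshift k m n u = x at h
  generalize hy : gshift k m n v = y at h
  induction h generalizing u v with
  | rel x y h => subst hx hy; exact .rel _ _ h.of_shift
  | refl x => rw [gshift_injective (hx.trans hy.symm)]; exact .refl _
  | symm x y _ ih => exact .symm _ _ (ih hy hx)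
  | trans x y z _ _ ih1 ih2 =>
    obtain ⟨w, rfl⟩ := gshift_surjective (k := k) (m := m) (n := n) y
    exact .trans _ _ _ (ih1 hx rfl) (ih2 rfl hy)

variable [NeZero k] [NeZero l] [NeZero m] [NeZero n]

instance finite_quot (α : AffineDiagram m n) (β : AffineDiagram k m) :
    Finite (Quot (JoinedOnCylinder α β)) := by
  have per : ∀ (N : ℕ) [NeZero N] (f : ℤ → Quot (JoinedOnCylinder α β)),
      (∀ i, f (i + N) = f i) → ∀ i, ∃ r : Fin N, f ((r : ℕ) : ℤ) = f i := by
    intro N _ f hf i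
    have hN : (0 : ℤ) < N := by exact_mod_cast Nat.pos_of_ne_zero (NeZero.ne N)
    refine ⟨⟨(i % N).toNat, ?_⟩, ?_⟩
    · have := Int.emod_lt_of_pos i hN
      have := Int.emod_nonneg i hN.ne'
      omega
    · have h1 : Function.Periodic f (N : ℤ) := hf
      have h2 := h1.int_mul (i / N) (i % N)
      have h3 : i % N + (i / N) * N = i := by rw [mul_comm]; exact Int.emod_add_mul_ediv i N
      rw [Int.cast_id, h3] at h2
      rw [h2]
      congr 1
      exact Int.toNat_of_nonneg (Int.emod_nonneg i hN.ne')
  let f : (Fin k ⊕ Fin n) ⊕ Fin m → Quot (JoinedOnCylinder α β) := fun x =>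
    Quot.mk _ (Sum.map (Sum.map (fun i : Fin k => ((i : ℕ) : ℤ)) (fun i : Fin n => ((i : ℕ) : ℤ)))
      (fun i : Fin m => ((i : ℕ) : ℤ)) x)
  have hsh : ∀ u, Quot.mk (JoinedOnCylinder α β) (gshift k m n u) = Quot.mk _ u :=
    fun u => (Quot.sound (r := JoinedOnCylinder α β) (Or.inr rfl)).symm
  refine Finite.of_surjective f ?_
  rintro ⟨(i | i) | i⟩
  · obtain ⟨r, hr⟩ := per k (fun i => Quot.mk _ (.inl (.inl i))) (fun i => hsh (.inl (.inl i))) i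
    exact ⟨.inl (.inl r), hr⟩
  · obtain ⟨r, hr⟩ := per n (fun i => Quot.mk _ (.inl (.inr i))) (fun i => hsh (.inl (.inr i))) i
    exact ⟨.inl (.inr r), hr⟩
  · obtain ⟨r, hr⟩ := per m (fun i => Quot.mk _ (.inr i)) (fun i => hsh (.inr i)) i
    exact ⟨.inr r, hr⟩

theorem cylinder_linked_aux {α : AffineDiagram m n} {β : AffineDiagram k m}
    {r : Pt → Pt → Prop} (hr : Equivalence r) (hs : ∀ p, r p (shift k n p)) {u v : GPt}
    (h : Relation.EqvGen (JoinedOnCylinder α β) u v) :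
    (∀ p, Linked α β u (.inl p) → ∃ q, Linked α β v (.inl q) ∧ r p q) ∧
    (∀ q, Linked α β v (.inl q) → ∃ p, Linked α β u (.inl p) ∧ r q p) := by
  induction h with
  | rel x y h =>
    rcases h with h | rfl
    · exact ⟨fun p hp => ⟨p, .trans _ _ _ (.rel _ _ h.symm) hp, hr.refl _⟩,
        fun p hp => ⟨p, .trans _ _ _ (.rel _ _ h) hp, hr.refl _⟩⟩
    · refine ⟨fun p hp => ⟨shift k n p, hp.shift, hs p⟩, fun q hq => ?_⟩
      obtain ⟨p, rfl⟩ := shift_surjective (m := k) (n := n) q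
      exact ⟨p, Linked.of_shift (v := .inl p) hq, hr.symm (hs p)⟩
  | refl x => exact ⟨fun p hp => ⟨p, hp, hr.refl _⟩, fun p hp => ⟨p, hp, hr.refl _⟩⟩
  | symm x y _ ih => exact ⟨ih.2, ih.1⟩
  | trans x y z _ _ ih1 ih2 =>
    constructor
    · intro p hp
      obtain ⟨q, hq, h1⟩ := ih1.1 p hp
      obtain ⟨q2, hq2, h2⟩ := ih2.1 q hq
      exact ⟨q2, hq2, hr.trans h1 h2⟩
    · intro p hp
      obtain ⟨q, hq, h1⟩ := ih2.2 p hp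
      obtain ⟨q2, hq2, h2⟩ := ih1.2 q hq
      exact ⟨q2, hq2, hr.trans h1 h2⟩

theorem cylinder_linked {α : AffineDiagram m n} {β : AffineDiagram k m}
    {r : Pt → Pt → Prop} (hr : Equivalence r) (hs : ∀ p, r p (shift k n p))
    (hc : ∀ p, r p (partner α β p)) {p q : Pt}
    (h : Relation.EqvGen (JoinedOnCylinder α β) (.inl p) (.inl q)) : r p q := by
  obtain ⟨q2, h1, h2⟩ := (cylinder_linked_aux hr hs h).1 p (.refl _)
  rcases linked_outer_iff.1 h1 with rfl | rfl
  · exact h2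
  · exact hr.trans h2 (hr.symm (hc q))

/- three diagrams glued: outer points, then the upper and the lower glued circle -/

abbrev GGPt := (Pt ⊕ ℤ) ⊕ ℤ

def upperPair : GPt → GGPt
  | .inl (.inl i) => .inr i
  | .inl (.inr i) => .inl (.inl (.inr i))
  | .inr i => .inl (.inr i)

def lowerRest : GPt → GGPt
  | .inl p => .inl (.inl p)
  | .inr i => .inr i

def lowerPair : GPt → GGPt
  | .inl (.inl i) => .inl (.inl (.inl i))
  | .inl (.inr i) => .inl (.inr i)
  | .inr i => .inr i

def upperRest : GPt → GGPt
  | .inl p => .inl (.inl p)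
  | .inr i => .inl (.inr i)

def UpperEdge (α : AffineDiagram m n) (u v : GPt) : Prop := ∃ p, u = upper p ∧ v = upper (α.arc p)

def LowerEdge (β : AffineDiagram k m) (u v : GPt) : Prop := ∃ p, u = lower p ∧ v = lower (β.arc p)

variable (α : AffineDiagram m n) (β : AffineDiagram k m) (γ : AffineDiagram l k)

theorem staged_upper : Staged (Joined α β) (LowerEdge γ) (Joined (α.comp β) γ)
    upperPair lowerRest where
  i_inj := by rintro ((a | a) | a) ((b | b) | b) h <;> simp_all [upperPair]
  j_inj := by rintro (a | a) (b | b) h <;> simp_all [lowerRest]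
  cover := by
    rintro ((p | a) | a)
    · exact Or.inr ⟨.inl p, rfl⟩
    · exact Or.inl ⟨.inr a, rfl⟩
    · exact Or.inr ⟨.inr a, rfl⟩
  sub a b h := Or.inr h
  induced u u2 w w2 h h1 h2 := by
    have key : ∀ u w, upperPair u = lowerRest w → ∃ p, u = .inl p ∧ w = upper p := by
      rintro ((a | a) | a) ((b | b) | b) h <;> simp [upperPair, lowerRest] at h <;> subst h
      · exact ⟨.inl a, rfl, rfl⟩
      · exact ⟨.inr a, rfl, rfl⟩
    obtain ⟨p, rfl, rfl⟩ := key _ _ h1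
    obtain ⟨p2, rfl, rfl⟩ := key _ _ h2
    rcases linked_outer_iff.1 h with rfl | rfl
    · exact .refl _
    · exact .rel _ _ (Or.inl ⟨p, rfl, rfl⟩)
  sound a b h := by
    rcases h with ⟨p, rfl, rfl⟩ | h
    · have e : ∀ p, lowerRest (upper p) = upperPair (.inl p) := by rintro (p | p) <;> rfl
      rw [e, e]
      exact Total.eqvGen_left (partner_spec α β p).2
    · exact .rel _ _ (Or.inr ⟨a, b, h, rfl, rfl⟩)

theorem staged_lower : Staged (Joined β γ) (UpperEdge α) (Joined α (β.comp γ))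
    lowerPair upperRest where
  i_inj := by rintro ((a | a) | a) ((b | b) | b) h <;> simp_all [lowerPair]
  j_inj := by rintro (a | a) (b | b) h <;> simp_all [upperRest]
  cover := by
    rintro ((p | a) | a)
    · exact Or.inr ⟨.inl p, rfl⟩
    · exact Or.inr ⟨.inr a, rfl⟩
    · exact Or.inl ⟨.inr a, rfl⟩
  sub a b h := Or.inl h
  induced u u2 w w2 h h1 h2 := by
    have key : ∀ u w, lowerPair u = upperRest w → ∃ p, u = .inl p ∧ w = lower p := by
      rintro ((a | a) | a) ((b | b) | b) h <;> simp [lowerPair, upperRest] at h <;> subst h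
      · exact ⟨.inl a, rfl, rfl⟩
      · exact ⟨.inr a, rfl, rfl⟩
    obtain ⟨p, rfl, rfl⟩ := key _ _ h1
    obtain ⟨p2, rfl, rfl⟩ := key _ _ h2
    rcases linked_outer_iff.1 h with rfl | rfl
    · exact .refl _
    · exact .rel _ _ (Or.inr ⟨p, rfl, rfl⟩)
  sound a b h := by
    rcases h with h | ⟨p, rfl, rfl⟩
    · exact .rel _ _ (Or.inr ⟨a, b, h, rfl, rfl⟩)
    · have e : ∀ p, upperRest (lower p) = lowerPair (.inl p) := by rintro (p | p) <;> rfl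
      rw [e, e]
      exact Total.eqvGen_left (partner_spec β γ p).2

theorem staged_upper_cylinder : Staged (JoinedOnCylinder α β)
    (fun u v => LowerEdge γ u v ∨ v = gshift l k n u) (JoinedOnCylinder (α.comp β) γ)
    upperPair lowerRest where
  i_inj := (staged_upper α β γ).i_inj
  j_inj := (staged_upper α β γ).j_inj
  cover := (staged_upper α β γ).cover
  sub a b h := h.imp_left Or.inr
  induced u u2 w w2 h h1 h2 := by
    have key : ∀ u w, upperPair u = lowerRest w → ∃ p, u = .inl p ∧ w = upper p := by
      rintro ((a | a) | a) ((b | b) | b) h <;> simp [upperPair, lowerRest] at h <;> subst h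
      · exact ⟨.inl a, rfl, rfl⟩
      · exact ⟨.inr a, rfl, rfl⟩
    obtain ⟨p, rfl, rfl⟩ := key _ _ h1
    obtain ⟨p2, rfl, rfl⟩ := key _ _ h2
    refine cylinder_linked
      (r := fun p q => Relation.EqvGen (JoinedOnCylinder (α.comp β) γ) (upper p) (upper q))
      ⟨fun _ => .refl _, fun h => .symm _ _ h, fun h h' => .trans _ _ _ h h'⟩ ?_ ?_ h
    · exact fun p => .rel _ _ (Or.inr (upper_shift p))
    · exact fun p => .rel _ _ (Or.inl (Or.inl ⟨p, rfl, rfl⟩))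
  sound a b h := by
    rcases h with (⟨p, rfl, rfl⟩ | h) | h
    · have e : ∀ p, lowerRest (upper p) = upperPair (.inl p) := by rintro (p | p) <;> rfl
      rw [e, e]
      exact Total.eqvGen_left
        (Relation.EqvGen.mono (fun _ _ h => Or.inl h) _ _ (partner_spec α β p).2)
    · exact .rel _ _ (Or.inr ⟨a, b, Or.inl h, rfl, rfl⟩)
    · exact .rel _ _ (Or.inr ⟨a, b, Or.inr h, rfl, rfl⟩)

theorem staged_lower_cylinder : Staged (JoinedOnCylinder β γ)
    (fun u v => UpperEdge α u v ∨ v = gshift l m n u) (JoinedOnCylinder α (β.comp γ))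
    lowerPair upperRest where
  i_inj := (staged_lower α β γ).i_inj
  j_inj := (staged_lower α β γ).j_inj
  cover := (staged_lower α β γ).cover
  sub a b h := h.imp_left Or.inl
  induced u u2 w w2 h h1 h2 := by
    have key : ∀ u w, lowerPair u = upperRest w → ∃ p, u = .inl p ∧ w = lower p := by
      rintro ((a | a) | a) ((b | b) | b) h <;> simp [lowerPair, upperRest] at h <;> subst h
      · exact ⟨.inl a, rfl, rfl⟩
      · exact ⟨.inr a, rfl, rfl⟩
    obtain ⟨p, rfl, rfl⟩ := key _ _ h1
    obtain ⟨p2, rfl, rfl⟩ := key _ _ h2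
    refine cylinder_linked
      (r := fun p q => Relation.EqvGen (JoinedOnCylinder α (β.comp γ)) (lower p) (lower q))
      ⟨fun _ => .refl _, fun h => .symm _ _ h, fun h h' => .trans _ _ _ h h'⟩ ?_ ?_ h
    · exact fun p => .rel _ _ (Or.inr (lower_shift p))
    · exact fun p => .rel _ _ (Or.inl (Or.inr ⟨p, rfl, rfl⟩))
  sound a b h := by
    rcases h with (h | ⟨p, rfl, rfl⟩) | h
    · exact .rel _ _ (Or.inr ⟨a, b, Or.inl h, rfl, rfl⟩)
    · have e : ∀ p, upperRest (lower p) = lowerPair (.inl p) := by rintro (p | p) <;> rfl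
      rw [e, e]
      exact Total.eqvGen_left
        (Relation.EqvGen.mono (fun _ _ h => Or.inl h) _ _ (partner_spec β γ p).2)
    · exact .rel _ _ (Or.inr ⟨a, b, Or.inr h, rfl, rfl⟩)

theorem total_eq : Total (Joined α β) (LowerEdge γ) upperPair lowerRest =
    Total (Joined β γ) (UpperEdge α) lowerPair upperRest := by
  have e1 : ∀ p, upperPair (upper p) = upperRest (upper p) := by rintro (p | p) <;> rfl
  have e2 : ∀ p, upperPair (lower p) = lowerPair (upper p) := by rintro (p | p) <;> rfl
  have e3 : ∀ p, lowerRest (lower p) = lowerPair (lower p) := by rintro (p | p) <;> rfl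
  funext x y
  refine propext ⟨?_, ?_⟩
  · rintro (⟨a, b, ⟨p, rfl, rfl⟩ | ⟨p, rfl, rfl⟩, rfl, rfl⟩ | ⟨a, b, ⟨p, rfl, rfl⟩, rfl, rfl⟩)
    · exact Or.inr ⟨_, _, ⟨p, rfl, rfl⟩, e1 _, e1 _⟩
    · exact Or.inl ⟨_, _, Or.inl ⟨p, rfl, rfl⟩, e2 _, e2 _⟩
    · exact Or.inl ⟨_, _, Or.inr ⟨p, rfl, rfl⟩, e3 _, e3 _⟩
  · rintro (⟨a, b, ⟨p, rfl, rfl⟩ | ⟨p, rfl, rfl⟩, rfl, rfl⟩ | ⟨a, b, ⟨p, rfl, rfl⟩, rfl, rfl⟩)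
    · exact Or.inl ⟨_, _, Or.inr ⟨p, rfl, rfl⟩, (e2 _).symm, (e2 _).symm⟩
    · exact Or.inr ⟨_, _, ⟨p, rfl, rfl⟩, (e3 _).symm, (e3 _).symm⟩
    · exact Or.inl ⟨_, _, Or.inl ⟨p, rfl, rfl⟩, (e1 _).symm, (e1 _).symm⟩

def ggshift (k l m n : ℕ) : GGPt → GGPt
  | .inl (.inl p) => .inl (.inl (shift l n p))
  | .inl (.inr i) => .inl (.inr (i + m))
  | .inr i => .inr (i + k)

theorem total_cylinder_iff {r₁ r₂ : GPt → GPt → Prop} {s₁ s₂ : GPt → GPt} {i j : GPt → GGPt}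
    {s : GGPt → GGPt} (hi : ∀ u, i (s₁ u) = s (i u)) (hj : ∀ u, j (s₂ u) = s (j u))
    (hc : ∀ v, (∃ u, v = i u) ∨ (∃ w, v = j w)) (x y : GGPt) :
    Total (fun u v => r₁ u v ∨ v = s₁ u) (fun u v => r₂ u v ∨ v = s₂ u) i j x y ↔
      Total r₁ r₂ i j x y ∨ y = s x := by
  constructor
  · rintro (⟨a, b, h | rfl, rfl, rfl⟩ | ⟨a, b, h | rfl, rfl, rfl⟩)
    · exact Or.inl (Or.inl ⟨a, b, h, rfl, rfl⟩)
    · exact Or.inr (hi _)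
    · exact Or.inl (Or.inr ⟨a, b, h, rfl, rfl⟩)
    · exact Or.inr (hj _)
  · rintro ((⟨a, b, h, rfl, rfl⟩ | ⟨a, b, h, rfl, rfl⟩) | rfl)
    · exact Or.inl ⟨a, b, Or.inl h, rfl, rfl⟩
    · exact Or.inr ⟨a, b, Or.inl h, rfl, rfl⟩
    · rcases hc x with ⟨u, rfl⟩ | ⟨u, rfl⟩
      · exact Or.inl ⟨u, s₁ u, Or.inr rfl, rfl, (hi u).symm⟩
      · exact Or.inr ⟨u, s₂ u, Or.inr rfl, rfl, (hj u).symm⟩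

theorem total_cylinder_eq :
    Total (JoinedOnCylinder α β) (fun u v => LowerEdge γ u v ∨ v = gshift l k n u)
      upperPair lowerRest =
    Total (JoinedOnCylinder β γ) (fun u v => UpperEdge α u v ∨ v = gshift l m n u)
      lowerPair upperRest := by
  funext x y
  have h1 := total_cylinder_iff (r₁ := Joined α β) (r₂ := LowerEdge γ) (s₁ := gshift k m n)
    (s₂ := gshift l k n) (i := upperPair) (j := lowerRest) (s := ggshift k l m n)
    (by rintro ((a | a) | a) <;> rfl) (by rintro (a | a) <;> rfl) (staged_upper α β γ).cover x y
  have h2 := total_cylinder_iff (r₁ := Joined β γ) (r₂ := UpperEdge α) (s₁ := gshift l k m)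
    (s₂ := gshift l m n) (i := lowerPair) (j := upperRest) (s := ggshift k l m n)
    (by rintro ((a | a) | a) <;> rfl) (by rintro (a | a) <;> rfl) (staged_lower α β γ).cover x y
  rw [total_eq] at h1
  exact propext (h1.trans h2.symm)

theorem AffineDiagram.comp_assoc : (α.comp β).comp γ = α.comp (β.comp γ) := by
  ext1
  funext p
  refine partner_eq (partner_spec α (β.comp γ) p).1 ?_
  have h := (partner_spec α (β.comp γ) p).2
  have h2 := (staged_lower α β γ).eqvGen_iff.2 h
  rw [← total_eq] at h2
  exact (staged_upper α β γ).eqvGen_iff.1 h2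

theorem loops_assoc :
    loops α β + loops (α.comp β) γ = loops β γ + loops α (β.comp γ) := by
  have h1 := (staged_upper_cylinder α β γ).card (Sum.inl : Pt → GPt)
  have h2 := (staged_lower_cylinder α β γ).card (Sum.inl : Pt → GPt)
  rw [← total_cylinder_eq] at h2
  have h3 := h1.symm.trans h2
  have c1 : Nat.card (Closed (JoinedOnCylinder α β) upperPair lowerRest) = loops α β := by
    refine Nat.card_congr (Equiv.subtypeEquivRight fun c => ⟨fun h p => ?_, fun h u w e => ?_⟩)
    · exact h _ (upper p) (by rcases p with p | p <;> rfl)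
    · rcases u with u | u
      · exact h u
      · rcases w with w | w <;> simp [upperPair, lowerRest] at e
  have c2 : Nat.card (Closed (JoinedOnCylinder β γ) lowerPair upperRest) = loops β γ := by
    refine Nat.card_congr (Equiv.subtypeEquivRight fun c => ⟨fun h p => ?_, fun h u w e => ?_⟩)
    · exact h _ (lower p) (by rcases p with p | p <;> rfl)
    · rcases u with u | u
      · exact h u
      · rcases w with w | w <;> simp [lowerPair, upperRest] at e
  rw [c1, c2] at h3
  rw [loops, loops, add_comm, add_comm (loops β γ)] 
  exact h3

end Assoc

section Algebra

variable {k l m n : ℕ}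

/-- The diagram `τ_k ^ r`, where the twist `τ_k` joins the bottom point `i` to the top point `i + 1`;
`twist k 0` is the identity diagram. -/
def twist (k : ℕ) (r : ℤ) : AffineDiagram k k where
  arc
    | .inl i => .inr (i + r)
    | .inr j => .inl (j - r)
  arc_arc := by rintro (i | i) <;> simp
  arc_ne := by rintro (i | i) <;> simp
  arc_shift := by rintro (i | i) <;> simp [shift] <;> ring
  noncrossing := by
    rintro (i | i) (j | j) ⟨h1, h2, h3⟩ <;> simp only [Before] at h1 h2 h3 <;> omega

theorem twist_injective (k : ℕ) : Function.Injective (twist k) := by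
  intro r s h
  have := congrFun (congrArg AffineDiagram.arc h) (.inl 0)
  simpa [twist] using this

theorem loops_eq_zero {α : AffineDiagram m n} {β : AffineDiagram k m}
    (h : ∀ i : ℤ, ∃ p : Pt, Linked α β (.inr i) (.inl p)) : loops α β = 0 := by
  rw [loops]
  have : IsEmpty {c : Quot (JoinedOnCylinder α β) // ∀ p : Pt, c ≠ Quot.mk _ (.inl p)} := by
    refine ⟨?_⟩
    rintro ⟨c, hc⟩
    induction c using Quot.ind with | _ u
    rcases u with p | i
    · exact hc p rfl
    · obtain ⟨p, hp⟩ := h i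
      exact hc p (Quot.eqvGen_sound (Relation.EqvGen.mono (fun _ _ h => Or.inl h) _ _ hp))
  exact Nat.card_of_isEmpty

theorem linked_twist_right (α : AffineDiagram m n) (r : ℤ) (i : ℤ) :
    Linked α (twist m r) (.inr i) (.inl (.inl (i - r))) :=
  .rel _ _ (Or.inr ⟨.inr i, rfl, rfl⟩)

theorem linked_twist_left (β : AffineDiagram k m) (r : ℤ) (i : ℤ) :
    Linked (twist m r) β (.inr i) (.inl (.inr (i + r))) :=
  .rel _ _ (Or.inl ⟨.inl i, rfl, rfl⟩)

theorem loops_twist_right (α : AffineDiagram m n) (r : ℤ) : loops α (twist m r) = 0 :=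
  loops_eq_zero fun i => ⟨_, linked_twist_right α r i⟩

theorem loops_twist_left (β : AffineDiagram k m) (r : ℤ) : loops (twist m r) β = 0 :=
  loops_eq_zero fun i => ⟨_, linked_twist_left β r i⟩

variable [NeZero k] [NeZero l] [NeZero m] [NeZero n]

theorem comp_twist_zero (α : AffineDiagram m n) : α.comp (twist m 0) = α := by
  ext1
  funext p
  have h : ∀ p, Linked α (twist m 0) (upper p) (.inl p) := by
    rintro (p | p)
    · have := linked_twist_right α 0 p
      rwa [sub_zero] at this
    · exact .refl _
  refine partner_eq (α.arc_ne p) ?_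
  exact .trans _ _ _ (.symm _ _ (h p)) (.trans _ _ _ (.rel _ _ (Or.inl ⟨p, rfl, rfl⟩)) (h _))

theorem twist_zero_comp (β : AffineDiagram k m) : (twist m 0).comp β = β := by
  ext1
  funext p
  have h : ∀ p, Linked (twist m 0) β (lower p) (.inl p) := by
    rintro (p | p)
    · exact .refl _
    · have := linked_twist_left β 0 p
      rwa [add_zero] at this
  refine partner_eq (β.arc_ne p) ?_
  exact .trans _ _ _ (.symm _ _ (h p)) (.trans _ _ _ (.rel _ _ (Or.inr ⟨p, rfl, rfl⟩)) (h _))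

theorem twist_comp_twist (r s : ℤ) : (twist k r).comp (twist k s) = twist k (r + s) := by
  ext1
  funext p
  rcases p with i | i
  · refine partner_eq (by simp [twist]) ?_
    have h1 := linked_twist_right (twist k r) s (i + s)
    have h2 := linked_twist_left (twist k s) r (i + s)
    rw [add_sub_cancel_right] at h1
    rw [add_assoc, add_comm s r] at h2
    exact .trans _ _ _ (.symm _ _ h1) h2
  · refine partner_eq (by simp [twist]) ?_
    have h1 := linked_twist_right (twist k r) s (i - r)
    have h2 := linked_twist_left (twist k s) r (i - r)
    rw [sub_add_cancel] at h2
    rw [sub_sub] at h1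
    exact .trans _ _ _ (.symm _ _ h2) h1

/-- The linear span `A_k` of the diagrams with `k` points on the bottom and `n` on the top. -/
abbrev DiagramSpan (k n : ℕ) : Type := AffineDiagram k n →₀ ℂ

/-- The bilinear multiplication `α β = δ ^ m(α, β) α ∘ β`. -/
noncomputable def compose (δ : ℂ) :
    DiagramSpan m n →ₗ[ℂ] DiagramSpan k m →ₗ[ℂ] DiagramSpan k n :=
  Finsupp.linearCombination ℂ fun α => Finsupp.linearCombination ℂ fun β =>
    Finsupp.single (α.comp β) (δ ^ loops α β)

theorem compose_single (δ : ℂ) (α : AffineDiagram m n) (β : AffineDiagram k m) (a b : ℂ) :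
    compose δ (Finsupp.single α a) (Finsupp.single β b) =
      Finsupp.single (α.comp β) (a * b * δ ^ loops α β) := by
  simp only [compose, Finsupp.linearCombination_single, LinearMap.smul_apply, Finsupp.smul_single,
    smul_eq_mul, mul_assoc]

theorem compose_assoc (δ : ℂ) (a : DiagramSpan m n) (b : DiagramSpan k m) (c : DiagramSpan l k) :
    compose δ (compose δ a b) c = compose δ a (compose δ b c) := by
  induction a using Finsupp.induction_linear with
  | zero => simp
  | add x y hx hy => simp [hx, hy]
  | single α x =>
    induction b using Finsupp.induction_linear with
    | zero => simp
    | add x y hx hy => simp [hx, hy]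
    | single β y =>
      induction c using Finsupp.induction_linear with
      | zero => simp
      | add x y hx hy => simp [hx, hy]
      | single γ z =>
        simp only [compose_single, AffineDiagram.comp_assoc]
        congr 1
        have := loops_assoc α β γ
        calc x * y * δ ^ loops α β * z * δ ^ loops (α.comp β) γ
            = x * y * z * δ ^ (loops α β + loops (α.comp β) γ) := by rw [pow_add]; ring
          _ = _ := by rw [this, pow_add]; ring

noncomputable def unitDiagram (n : ℕ) : DiagramSpan n n := Finsupp.single (twist n 0) 1

theorem compose_unit (δ : ℂ) (a : DiagramSpan m n) : compose δ a (unitDiagram m) = a := by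
  induction a using Finsupp.induction_linear with
  | zero => simp
  | add x y hx hy => simp [hx, hy]
  | single α x => simp [unitDiagram, compose_single, comp_twist_zero, loops_twist_right]

theorem unit_compose (δ : ℂ) (a : DiagramSpan m n) : compose δ (unitDiagram n) a = a := by
  induction a using Finsupp.induction_linear with
  | zero => simp
  | add x y hx hy => simp [hx, hy]
  | single α x => simp [unitDiagram, compose_single, twist_zero_comp, loops_twist_left]

/-- The algebra `T_n(δ)` (`n` odd): the span of the diagrams with `n` points on the bottom and on the
top, with the multiplication `compose δ`. -/
def TL (_δ : ℂ) (n : ℕ) : Type := DiagramSpan n n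

variable (δ : ℂ)

noncomputable instance : AddCommGroup (TL δ n) := inferInstanceAs (AddCommGroup (DiagramSpan n n))

noncomputable instance : Module ℂ (TL δ n) := inferInstanceAs (Module ℂ (DiagramSpan n n))

noncomputable instance : Ring (TL δ n) :=
  { (inferInstance : AddCommGroup (TL δ n)) with
    mul := fun a b => compose δ (a : DiagramSpan n n) (b : DiagramSpan n n)
    one := unitDiagram n
    left_distrib := fun a b c => map_add (compose δ (a : DiagramSpan n n)) b c
    right_distrib := fun a b c => LinearMap.map_add₂ (compose δ) a b c
    zero_mul := fun a => LinearMap.map_zero₂ (compose δ) a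
    mul_zero := fun a => map_zero (compose δ (a : DiagramSpan n n))
    mul_assoc := fun a b c => compose_assoc δ a b c
    one_mul := fun a => unit_compose δ a
    mul_one := fun a => compose_unit δ a }

theorem TL.mul_def (a b : TL δ n) : a * b = compose δ (a : DiagramSpan n n) b := rfl

theorem TL.one_def : (1 : TL δ n) = unitDiagram n := rfl

noncomputable instance : Algebra ℂ (TL δ n) :=
  Algebra.ofModule (fun r a b => LinearMap.map_smul₂ (compose δ) r a b)
    (fun r a b => map_smul (compose δ (a : DiagramSpan n n)) r b)

/-- No arc joins the bottom to the bottom, i.e. there are `k` through arcs. -/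
def AffineDiagram.Monic (β : AffineDiagram k n) : Prop := ∀ i : ℤ, ∃ j : ℤ, β.arc (.inl i) = .inr j

/-- `B_k`: the span of the diagrams in `A_k` with strictly less than `k` through arcs. -/
noncomputable def fewerThrough (k n : ℕ) : Submodule ℂ (DiagramSpan k n) :=
  Finsupp.supported ℂ ℂ {β : AffineDiagram k n | ¬ β.Monic}

/-- `C_k = A_k / B_k`. -/
abbrev CellModule (k n : ℕ) : Type := DiagramSpan k n ⧸ fewerThrough k n

/-- `F ↦ F(τ_k)`, i.e. `∑ F_r x ^ r ↦ ∑ F_r τ_k ^ r`. -/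
noncomputable def atTwist (k : ℕ) : ℂ[T;T⁻¹] →ₗ[ℂ] DiagramSpan k k :=
  (Finsupp.lmapDomain ℂ ℂ (twist k)).comp
    (AddMonoidAlgebra.coeffLinearEquiv ℂ : ℂ[T;T⁻¹] ≃ₗ[ℂ] _).toLinearMap

theorem atTwist_single (r : ℤ) (a : ℂ) :
    atTwist k (.single r a) = Finsupp.single (twist k r) a :=
  Finsupp.mapDomain_single

theorem atTwist_mul (F G : ℂ[T;T⁻¹]) :
    atTwist k (F * G) = compose δ (atTwist k F) (atTwist k G) := by
  induction F using AddMonoidAlgebra.induction_linear with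
  | zero => simp
  | add x y hx hy => rw [add_mul, map_add, map_add, hx, hy, LinearMap.map_add₂]
  | single r a =>
    induction G using AddMonoidAlgebra.induction_linear with
    | zero => simp
    | add x y hx hy => rw [mul_add, map_add, map_add, hx, hy, map_add]
    | single s b =>
      rw [AddMonoidAlgebra.single_mul_single, atTwist_single, atTwist_single, atTwist_single,
        compose_single, twist_comp_twist, loops_twist_left, pow_zero, mul_one]

theorem atTwist_one : atTwist k 1 = unitDiagram k := atTwist_single 0 1

theorem compose_mem_fewerThrough (a : DiagramSpan m n) {b : DiagramSpan k m}
    (hb : b ∈ fewerThrough k m) : compose δ a b ∈ fewerThrough k n := by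
  induction a using Finsupp.induction_linear with
  | zero => simp
  | add x y hx hy => rw [LinearMap.map_add₂]; exact add_mem hx hy
  | single α x =>
    rw [fewerThrough, Finsupp.supported_eq_span_single] at hb
    induction hb using Submodule.span_induction with
    | zero => simp
    | add x y _ _ hx hy => rw [map_add]; exact add_mem hx hy
    | smul c x _ hx => rw [map_smul]; exact Submodule.smul_mem _ _ hx
    | mem x hx =>
      obtain ⟨β, hβ, rfl⟩ := hx
      rw [compose_single]
      refine Finsupp.single_mem_supported ℂ _ ?_
      intro hm
      apply hβ
      intro i
      rcases h : β.arc (.inl i) with j | j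
      · exfalso
        obtain ⟨j2, hj2⟩ := hm i
        have : partner α β (.inl i) = .inl j := by
          refine partner_eq ?_ (.rel _ _ (Or.inr ⟨.inl i, rfl, by rw [h]; rfl⟩))
          rw [← h]
          exact β.arc_ne _
        rw [show (α.comp β).arc (.inl i) = partner α β (.inl i) from rfl, this] at hj2
        simp at hj2
      · exact ⟨j, rfl⟩

theorem twist_monic (r : ℤ) : (twist k r).Monic := fun i => ⟨i + r, rfl⟩

theorem eq_twist_of_monic {α : AffineDiagram k k} (hα : α.Monic) : ∃ r, α = twist k r := by
  choose f hf using hα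
  have hmono : StrictMono f := by
    intro i j hij
    by_contra hle
    have hne : f i ≠ f j := by
      intro h
      have h2 : α.arc (.inl i) = α.arc (.inl j) := by rw [hf, hf, h]
      have h3 := congrArg α.arc h2
      rw [α.arc_arc, α.arc_arc] at h3
      simp at h3
      omega
    apply α.noncrossing (.inl i) (.inl j)
    rw [hf, hf]
    refine ⟨hij, trivial, ?_⟩
    change f j < f i
    omega
  have hper : ∀ i, f (i + k) = f i + k := by
    intro i
    have h1 := α.arc_shift (.inl i)
    rw [hf] at h1
    change α.arc (.inl (i + k)) = .inr (f i + k) at h1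
    rw [hf] at h1
    exact Sum.inr_injective h1
  have hstep : ∀ i, f i + 1 ≤ f (i + 1) := fun i => hmono (lt_add_one i)
  have hge : ∀ (i : ℤ) (t : ℕ), f i + t ≤ f (i + t) := by
    intro i t
    induction t with
    | zero => simp
    | succ t ih =>
      have := hstep (i + t)
      push_cast
      rw [← add_assoc, ← add_assoc]
      omega
  have hk : 0 < k := Nat.pos_of_ne_zero (NeZero.ne k)
  have hone : ∀ i, f (i + 1) = f i + 1 := by
    intro i
    have h1 := hge (i + 1) (k - 1)
    have h2 := hper i
    have h3 := hstep i
    have h4 : i + 1 + ((k - 1 : ℕ) : ℤ) = i + k := by omega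
    rw [h4, h2] at h1
    omega
  have hall : ∀ i, f i = i + f 0 := by
    intro i
    induction i using Int.induction_on with
    | zero => simp
    | succ i ih => rw [hone, ih]; ring
    | pred i ih =>
      have := hone (-i - 1)
      rw [sub_add_cancel, ih] at this
      omega
  have hl : ∀ i, α.arc (.inl i) = .inr (i + f 0) := fun i => by rw [hf, hall]
  refine ⟨f 0, ?_⟩
  ext1
  funext p
  rcases p with i | i
  · exact hl i
  · have := hl (i - f 0)
    rw [sub_add_cancel] at this
    have h2 := congrArg α.arc this
    rw [α.arc_arc] at h2
    exact h2.symm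

/-- Modulo the diagrams with fewer than `k` through arcs, `T_k` is `ℂ[τ_k, τ_k⁻¹]`. -/
theorem exists_atTwist (a : DiagramSpan k k) :
    ∃ F, a - atTwist k F ∈ fewerThrough k k := by
  classical
  induction a using Finsupp.induction_linear with
  | zero => exact ⟨0, by simp⟩
  | add x y hx hy =>
    obtain ⟨F, hF⟩ := hx
    obtain ⟨G, hG⟩ := hy
    refine ⟨F + G, ?_⟩
    rw [map_add, add_sub_add_comm]
    exact add_mem hF hG
  | single α c =>
    by_cases h : α.Monic
    · obtain ⟨r, rfl⟩ := eq_twist_of_monic h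
      refine ⟨.single r c, ?_⟩
      rw [atTwist_single, sub_self]
      exact zero_mem _
    · refine ⟨0, ?_⟩
      rw [map_zero, sub_zero]
      exact Finsupp.single_mem_supported ℂ _ h

theorem eq_zero_of_atTwist_mem {F : ℂ[T;T⁻¹]} (h : atTwist k F ∈ fewerThrough k k) : F = 0 := by
  ext r
  by_contra hr
  have h1 : (atTwist k F) (twist k r) = F.coeff r :=
    Finsupp.mapDomain_apply (twist_injective k) _ _
  have h2 : twist k r ∈ (atTwist k F).support := by
    rw [Finsupp.mem_support_iff, h1]
    exact hr
  exact h h2 (twist_monic r)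

/-- `f ∈ T_n(δ)` acts on `C_k` from the left as the scalar `F ∈ ℂ[x, x⁻¹]` does from the right, where
`x` acts by right multiplication with `τ_k`. -/
def ActsAs (f : TL δ n) (k : ℕ) [NeZero k] (F : ℂ[T;T⁻¹]) : Prop :=
  ∀ v : DiagramSpan k n, (Submodule.Quotient.mk (compose δ (f : DiagramSpan n n) v) : CellModule k n) =
    Submodule.Quotient.mk (compose δ v (atTwist k F))

/-- A condition under which central elements act on `C_k` by scalars. It is proved below for `n = 3`
and `k = 1, 3`. -/
def Splits (k n : ℕ) [NeZero k] [NeZero n] : Prop :=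
  ∃ (μ : DiagramSpan n k) (γ : DiagramSpan k n), compose δ μ γ = unitDiagram k

variable {δ}

theorem ActsAs.unique (h : Splits δ k n) {f : TL δ n} {F G : ℂ[T;T⁻¹]} (hF : ActsAs δ f k F)
    (hG : ActsAs δ f k G) : F = G := by
  obtain ⟨μ, γ, hμ⟩ := h
  have h1 := (hF γ).symm.trans (hG γ)
  rw [Submodule.Quotient.eq, ← map_sub, ← map_sub] at h1
  have h2 := compose_mem_fewerThrough δ μ h1
  rw [← compose_assoc, hμ, unit_compose] at h2
  exact sub_eq_zero.1 (eq_zero_of_atTwist_mem h2)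

theorem exists_actsAs (h : Splits δ k n) (f : Subalgebra.center ℂ (TL δ n)) :
    ∃ F, ActsAs δ (f : TL δ n) k F := by
  obtain ⟨μ, γ, hμ⟩ := h
  set a : DiagramSpan n n := (f : TL δ n) with ha
  have hc : ∀ b : DiagramSpan n n, compose δ a b = compose δ b a := fun b =>
    ((Subalgebra.mem_center_iff.1 f.2) b).symm
  obtain ⟨F, hF⟩ := exists_atTwist (compose δ (compose δ μ a) γ)
  refine ⟨F, fun v => ?_⟩
  have e : compose δ a v = compose δ v (compose δ (compose δ μ a) γ) := by
    calc compose δ a v = compose δ a (compose δ v (compose δ μ γ)) := by rw [hμ, compose_unit]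
      _ = compose δ (compose δ a (compose δ v μ)) γ := by rw [← compose_assoc, ← compose_assoc, compose_assoc δ a v μ]
      _ = _ := by rw [hc, compose_assoc δ v μ, compose_assoc δ v]
  rw [Submodule.Quotient.eq]
  change compose δ a v - _ ∈ _
  rw [e, ← map_sub]
  exact compose_mem_fewerThrough δ v hF

theorem existsUnique_actsAs (h : Splits δ k n) (f : Subalgebra.center ℂ (TL δ n)) :
    ∃! F, ActsAs δ (f : TL δ n) k F := by
  obtain ⟨F, hF⟩ := exists_actsAs h f
  exact ⟨F, hF, fun G hG => ActsAs.unique h hG hF⟩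

theorem ActsAs.add {f g : TL δ n} {F G : ℂ[T;T⁻¹]} (hF : ActsAs δ f k F) (hG : ActsAs δ g k G) :
    ActsAs δ (f + g) k (F + G) := by
  intro v
  have h1 : compose δ ((f + g : TL δ n) : DiagramSpan n n) v =
      compose δ (f : DiagramSpan n n) v + compose δ (g : DiagramSpan n n) v :=
    LinearMap.map_add₂ (compose δ) _ _ _
  rw [h1, map_add, map_add, Submodule.Quotient.mk_add, Submodule.Quotient.mk_add, hF v, hG v]

theorem ActsAs.mul {f g : TL δ n} {F G : ℂ[T;T⁻¹]} (hF : ActsAs δ f k F) (hG : ActsAs δ g k G) :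
    ActsAs δ (f * g) k (F * G) := by
  intro v
  have h1 : compose δ ((f * g : TL δ n) : DiagramSpan n n) v =
      compose δ (f : DiagramSpan n n) (compose δ (g : DiagramSpan n n) v) :=
    compose_assoc δ _ _ _
  have h2 := hG v
  rw [Submodule.Quotient.eq] at h2
  have h3 := compose_mem_fewerThrough δ (f : DiagramSpan n n) h2
  rw [map_sub, ← Submodule.Quotient.eq] at h3
  rw [h1, h3, hF, mul_comm F G, atTwist_mul δ, ← compose_assoc]

theorem ActsAs.scalar (c : ℂ) : ActsAs δ (algebraMap ℂ (TL δ n) c) k (LaurentPolynomial.C c) := by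
  intro v
  have h1 : (algebraMap ℂ (TL δ n) c : DiagramSpan n n) = c • unitDiagram n :=
    Algebra.algebraMap_eq_smul_one c
  have h2 : atTwist k (LaurentPolynomial.C c) = c • unitDiagram k := by
    rw [← LaurentPolynomial.single_eq_C, atTwist_single, unitDiagram, Finsupp.smul_single,
      smul_eq_mul, mul_one]
  rw [h1, h2, LinearMap.map_smul₂, map_smul, unit_compose, compose_unit]

/-- The component `f_k` of a central element `f` of `T_n(δ)`: the unique Laurent polynomial that acts
on `C_k` as `f` does. -/
noncomputable def component (h : Splits δ k n) : Subalgebra.center ℂ (TL δ n) →ₐ[ℂ] ℂ[T;T⁻¹] :=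
  have spec : ∀ f : Subalgebra.center ℂ (TL δ n), ActsAs δ (f : TL δ n) k (existsUnique_actsAs h f).choose :=
    fun f => (existsUnique_actsAs h f).choose_spec.1
  { toFun := fun f => (existsUnique_actsAs h f).choose
    map_one' := ActsAs.unique h (spec 1) (by simpa using ActsAs.scalar (k := k) (n := n) (δ := δ) 1)
    map_mul' := fun f g => ActsAs.unique h (spec (f * g)) ((spec f).mul (spec g))
    map_zero' := ActsAs.unique h (spec 0) (by simpa using ActsAs.scalar (k := k) (n := n) (δ := δ) 0)
    map_add' := fun f g => ActsAs.unique h (spec (f + g)) ((spec f).add (spec g))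
    commutes' := fun c => ActsAs.unique h (spec _) (ActsAs.scalar c) }

theorem component_spec (h : Splits δ k n) (f : Subalgebra.center ℂ (TL δ n)) :
    ActsAs δ (f : TL δ n) k (component h f) :=
  (existsUnique_actsAs h f).choose_spec.1

/-- The homomorphism `ψ_{k,z} : f ↦ f_k(z)` on the centre. -/
noncomputable def evalComponent (h : Splits δ k n) (z : ℂˣ) :
    Subalgebra.center ℂ (TL δ n) →+* ℂ :=
  (LaurentPolynomial.eval₂ (RingHom.id ℂ) z).comp (component h : _ →+* ℂ[T;T⁻¹])

theorem evalComponent_surjective (h : Splits δ k n) (z : ℂˣ) :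
    Function.Surjective (evalComponent h z) := by
  intro c
  refine ⟨algebraMap ℂ _ c, ?_⟩
  simp [evalComponent]

end Algebra

section Three

/-- bottom `i` to top `3 i - 2`; top `2` to top `3` -/
def capDiagram : AffineDiagram 1 3 where
  arc
    | .inl i => .inr (3 * i - 2)
    | .inr j => if j % 3 = 1 then .inl (j / 3 + 1) else if j % 3 = 2 then .inr (j + 1)
        else .inr (j - 1)
  arc_arc := by
    rintro (i | i)
    · simp only
      rw [if_pos (by omega)]
      congr 1; omega
    · simp only
      split_ifs <;> (try simp only) <;> (try split_ifs) <;> first | omega | (congr 1; omega)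
  arc_ne := by
    rintro (i | i)
    · simp
    · simp only
      split_ifs <;> simp
  arc_shift := by
    rintro (i | i)
    · simp only [shift]
      congr 1; push_cast; ring
    · simp only [shift]
      push_cast
      split_ifs <;> (try simp only) <;> first | omega | (congr 1; omega)
  noncrossing := by
    rintro (i | i) (j | j) ⟨h1, h2, h3⟩ <;> (try simp only at h1 h2 h3) <;>
      (try split_ifs at h1 h2 h3) <;> (try simp only [Before] at h1 h2 h3) <;> omega

/-- bottom `3` to top `1`; bottom `1` to bottom `2` -/
def cupDiagram : AffineDiagram 3 1 where
  arc
    | .inr i => .inl (3 * i)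
    | .inl j => if j % 3 = 0 then .inr (j / 3) else if j % 3 = 1 then .inl (j + 1)
        else .inl (j - 1)
  arc_arc := by
    rintro (i | i)
    · simp only
      split_ifs <;> (try simp only) <;> (try split_ifs) <;> first | omega | (congr 1; omega)
    · simp only
      rw [if_pos (by omega)]
      congr 1; omega
  arc_ne := by
    rintro (i | i)
    · simp only
      split_ifs <;> simp
    · simp
  arc_shift := by
    rintro (i | i)
    · simp only [shift]
      push_cast
      split_ifs <;> (try simp only) <;> first | omega | (congr 1; omega)
    · simp only [shift]
      congr 1; push_cast; ring
  noncrossing := by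
    rintro (i | i) (j | j) ⟨h1, h2, h3⟩ <;> (try simp only at h1 h2 h3) <;>
      (try split_ifs at h1 h2 h3) <;> (try simp only [Before] at h1 h2 h3) <;> omega

theorem cup_linked_cap (i : ℤ) :
    Linked cupDiagram capDiagram (.inl (.inl i)) (.inr (3 * i - 2)) ∧
    Linked cupDiagram capDiagram (.inr (3 * i - 2)) (.inr (3 * i - 1)) ∧
    Linked cupDiagram capDiagram (.inr (3 * i - 1)) (.inr (3 * i)) ∧
    Linked cupDiagram capDiagram (.inr (3 * i)) (.inl (.inr i)) := by
  refine ⟨.rel _ _ (Or.inr ⟨.inl i, rfl, rfl⟩), .rel _ _ (Or.inl ⟨.inl (3 * i - 2), rfl, ?_⟩),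
    .rel _ _ (Or.inr ⟨.inr (3 * i - 1), rfl, ?_⟩), .symm _ _ (.rel _ _ (Or.inl ⟨.inr i, rfl, rfl⟩))⟩
  · simp only [cupDiagram]
    rw [if_neg (by omega), if_pos (by omega)]
    simp only [upper]
    congr 1; omega
  · simp only [capDiagram]
    rw [if_neg (by omega), if_pos (by omega)]
    simp only [lower]
    congr 1; omega

theorem splits_one_three (δ : ℂ) : Splits δ 1 3 := by
  refine ⟨Finsupp.single cupDiagram 1, Finsupp.single capDiagram 1, ?_⟩
  have hl : loops cupDiagram capDiagram = 0 := by
    refine loops_eq_zero fun j => ?_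
    obtain ⟨i, rfl | rfl | rfl⟩ : ∃ i, j = 3 * i - 2 ∨ j = 3 * i - 1 ∨ j = 3 * i :=
      ⟨(j + 2) / 3, by omega⟩
    · exact ⟨_, .symm _ _ (cup_linked_cap i).1⟩
    · exact ⟨_, .trans _ _ _ (cup_linked_cap i).2.2.1 (cup_linked_cap i).2.2.2⟩
    · exact ⟨_, (cup_linked_cap i).2.2.2⟩
  have hc : cupDiagram.comp capDiagram = twist 1 0 := by
    have h : ∀ i, Linked cupDiagram capDiagram (.inl (.inl i)) (.inl (.inr i)) := fun i =>
      .trans _ _ _ (cup_linked_cap i).1 (.trans _ _ _ (cup_linked_cap i).2.1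
        (.trans _ _ _ (cup_linked_cap i).2.2.1 (cup_linked_cap i).2.2.2))
    ext1
    funext p
    rcases p with i | i
    · refine partner_eq (by simp [twist]) ?_
      simpa [twist, Linked] using h i
    · refine partner_eq (by simp [twist]) (.symm _ _ ?_)
      simpa [twist, Linked] using h i
  rw [compose_single, hl, hc, unitDiagram]
  simp

theorem splits_self (δ : ℂ) (n : ℕ) [NeZero n] : Splits δ n n :=
  ⟨unitDiagram n, unitDiagram n, unit_compose _ _⟩

/-- The centre of `T_3(δ)`. -/
noncomputable abbrev CenterT3 (δ : ℂ) : Subalgebra ℂ (TL δ 3) := Subalgebra.center ℂ (TL δ 3)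

/-- The points of the affine variety `V_3` with coordinate ring the centre of `T_3(δ)`. -/
abbrev V3 (δ : ℂ) : Type := MaximalSpectrum (CenterT3 δ)

/-- `Ψ : S_3 ⊔ S_1 → V_3` with `S_3 = S_1 = ℂˣ`; `inl z` is the point `z` of `S_3`, `inr w` is the
point `w` of `S_1`. The point `Ψ(z)` is the maximal ideal `ker ψ_{k,z}`, `z ∈ S_k`. -/
noncomputable def Psi (δ : ℂ) : ℂˣ ⊕ ℂˣ → V3 δ
  | .inl z => ⟨RingHom.ker (evalComponent (splits_self δ 3) z),
      RingHom.ker_isMaximal_of_surjective _ (evalComponent_surjective _ z)⟩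
  | .inr w => ⟨RingHom.ker (evalComponent (splits_one_three δ) w),
      RingHom.ker_isMaximal_of_surjective _ (evalComponent_surjective _ w)⟩

end Three
end AffineTL

/-! Everything reduces to Laurent polynomials. Each diagram with one bottom and three top points is
a single cap rotated by a power of the twist, so the span of these diagrams is free of rank one over
`ℂ[T;T⁻¹]`, with `T` acting as `τ_3` from the left. Right multiplication by `τ_1` is then
multiplication by `T ^ 3`. The mirrored statement holds for cups, and every diagram on three points
with fewer than three through arcs is a cap after a cup. Gluing cups to caps is governed by one
polynomial: the pairing of `G` with `F` is the part of `gram * G * F` with exponents divisible by 3,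
where `gram = δ + T ^ 2 + T ^ (-2)`. Its zeros are `±√q` and `±1/√q`, the points `z_i`.

The element `F(τ) + θ_h`, where `θ_h` is the sum of three rotated copies of `h(τ)` cap cup, acts on
the caps as multiplication by `F + gram * h`. If this equals `f(T ^ 3)`, the element is central with
components `(F, f)` (`exists_center`). Conversely, at a zero `z` of `gram` the ideal of diagrams
with fewer than three through arcs acts degenerately, which forces `f_3(z) = f_1(z ^ 3)` for every
central element (`evalComponent_eq_of_gram_eq_zero`). This gives the gluing `Ψ(z_i) = Ψ(w_i)`.

Away from the glued points, the prescribed central elements with components `(gram * (T - y), 0)`,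
`(gram, 0)` and `(0, ∏ (T - w_i) * (T - y))` separate points; the last exists because `gram` divides
`∏ (T ^ 3 - z_i ^ 3)`. For surjectivity, the two components together map the centre to `ℂ[T;T⁻¹] ×
ℂ[T;T⁻¹]`. The kernel consists of elements of square zero (`mul_self_eq_zero_of_components`) and the
extension is integral (`isIntegral_of_components`), so every maximal ideal of the centre lies under
a maximal ideal of the product, and by the Nullstellensatz the latter is a point of `S_3` or `S_1`.
-/

namespace AffineTL

/-! ### Diagrams with one through arc: caps and cups. -/

section Diagrams

/-- bottom `i` to top `3 i + a`; top `3 i + a + 1` to top `3 i + a + 2` -/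
def capAt (a : ℤ) : AffineDiagram 1 3 where
  arc
    | .inl i => .inr (3 * i + a)
    | .inr j => if (j - a) % 3 = 0 then .inl ((j - a) / 3) else if (j - a) % 3 = 1 then .inr (j + 1)
        else .inr (j - 1)
  arc_arc := by
    rintro (i | i)
    · simp only
      rw [if_pos (by omega)]
      congr 1; omega
    · simp only
      split_ifs <;> (try simp only) <;> (try split_ifs) <;> first | omega | (congr 1; omega)
  arc_ne := by
    rintro (i | i)
    · simp
    · simp only
      split_ifs <;> simp
  arc_shift := by
    rintro (i | i)
    · simp only [shift]
      congr 1; push_cast; ring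
    · simp only [shift]
      push_cast
      split_ifs <;> (try simp only) <;> first | omega | (congr 1; omega)
  noncrossing := by
    rintro (i | i) (j | j) ⟨h1, h2, h3⟩ <;> (try simp only at h1 h2 h3) <;>
      (try split_ifs at h1 h2 h3) <;> (try simp only [Before] at h1 h2 h3) <;> omega

/-- top `i` to bottom `3 i + b`; bottom `3 i + b + 1` to bottom `3 i + b + 2` -/
def cupAt (b : ℤ) : AffineDiagram 3 1 where
  arc
    | .inr i => .inl (3 * i + b)
    | .inl j => if (j - b) % 3 = 0 then .inr ((j - b) / 3) else if (j - b) % 3 = 1 then .inl (j + 1)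
        else .inl (j - 1)
  arc_arc := by
    rintro (i | i)
    · simp only
      split_ifs <;> (try simp only) <;> (try split_ifs) <;> first | omega | (congr 1; omega)
    · simp only
      rw [if_pos (by omega)]
      congr 1; omega
  arc_ne := by
    rintro (i | i)
    · simp only
      split_ifs <;> simp
    · simp
  arc_shift := by
    rintro (i | i)
    · simp only [shift]
      push_cast
      split_ifs <;> (try simp only) <;> first | omega | (congr 1; omega)
    · simp only [shift]
      congr 1; push_cast; ring
  noncrossing := by
    rintro (i | i) (j | j) ⟨h1, h2, h3⟩ <;> (try simp only at h1 h2 h3) <;>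
      (try split_ifs at h1 h2 h3) <;> (try simp only [Before] at h1 h2 h3) <;> omega

theorem capAt_inl (a i : ℤ) : (capAt a).arc (.inl i) = .inr (3 * i + a) := rfl

theorem capAt_through {a i j : ℤ} (h : j = 3 * i + a) : (capAt a).arc (.inr j) = .inl i := by
  simp only [capAt]
  rw [if_pos (by omega)]
  congr 1; omega

theorem capAt_right {a i j : ℤ} (h : j = 3 * i + a + 1) :
    (capAt a).arc (.inr j) = .inr (j + 1) := by
  simp only [capAt]
  rw [if_neg (by omega), if_pos (by omega)]

theorem capAt_left {a i j : ℤ} (h : j = 3 * i + a + 2) :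
    (capAt a).arc (.inr j) = .inr (j - 1) := by
  simp only [capAt]
  rw [if_neg (by omega), if_neg (by omega)]

theorem cupAt_inr (b i : ℤ) : (cupAt b).arc (.inr i) = .inl (3 * i + b) := rfl

theorem cupAt_through {b i j : ℤ} (h : j = 3 * i + b) : (cupAt b).arc (.inl j) = .inr i := by
  simp only [cupAt]
  rw [if_pos (by omega)]
  congr 1; omega

theorem cupAt_right {b i j : ℤ} (h : j = 3 * i + b + 1) :
    (cupAt b).arc (.inl j) = .inl (j + 1) := by
  simp only [cupAt]
  rw [if_neg (by omega), if_pos (by omega)]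

theorem cupAt_left {b i j : ℤ} (h : j = 3 * i + b + 2) :
    (cupAt b).arc (.inl j) = .inl (j - 1) := by
  simp only [cupAt]
  rw [if_neg (by omega), if_neg (by omega)]

theorem exists_residue_three (a j : ℤ) :
    ∃ i, j = 3 * i + a ∨ j = 3 * i + a + 1 ∨ j = 3 * i + a + 2 :=
  ⟨(j - a) / 3, by omega⟩

/-! ### Recognising composites; gluing with twists. -/

section General

variable {k m n : ℕ}

theorem linked_upper (α : AffineDiagram m n) (β : AffineDiagram k m) (p : Pt) :
    Linked α β (upper p) (upper (α.arc p)) :=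
  .rel _ _ (Or.inl ⟨p, rfl, rfl⟩)

theorem linked_lower (α : AffineDiagram m n) (β : AffineDiagram k m) (p : Pt) :
    Linked α β (lower p) (lower (β.arc p)) :=
  .rel _ _ (Or.inr ⟨p, rfl, rfl⟩)

variable [NeZero k] [NeZero m] [NeZero n]

theorem AffineDiagram.comp_eq {α : AffineDiagram m n} {β : AffineDiagram k m}
    {γ : AffineDiagram k n} (h : ∀ p, Linked α β (.inl p) (.inl (γ.arc p))) : α.comp β = γ := by
  ext1
  funext p
  exact partner_eq (γ.arc_ne p) (h p)

/-- Translation of the points of the top line. -/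
def moveTop (r : ℤ) : Pt → Pt
  | .inl i => .inl i
  | .inr j => .inr (j + r)

/-- Translation of the points of the bottom line. -/
def moveBottom (r : ℤ) : Pt → Pt
  | .inl i => .inl (i + r)
  | .inr j => .inr j

/-- Gluing a twist on top only relabels the top points, so the composite is the relabelled `β`. The
relabelling is onto, which is why the hypothesis may be stated at points `moveTop r p`. -/
theorem twist_comp_eq {r : ℤ} {β γ : AffineDiagram k m}
    (h : ∀ p, γ.arc (moveTop r p) = moveTop r (β.arc p)) : (twist m r).comp β = γ := by
  have hl : ∀ p, Linked (twist m r) β (lower p) (.inl (moveTop r p)) := by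
    rintro (p | p)
    · exact .refl _
    · exact linked_twist_left β r p
  have hs : ∀ p, ∃ s, p = moveTop r s := by
    rintro (p | p)
    · exact ⟨.inl p, rfl⟩
    · exact ⟨.inr (p - r), by simp [moveTop]⟩
  refine AffineDiagram.comp_eq fun p => ?_
  obtain ⟨p, rfl⟩ := hs p
  rw [h]
  exact .trans _ _ _ (.symm _ _ (hl p)) (.trans _ _ _ (linked_lower _ _ p) (hl _))

theorem comp_twist_eq {r : ℤ} {α γ : AffineDiagram m n}
    (h : ∀ p, γ.arc (moveBottom (-r) p) = moveBottom (-r) (α.arc p)) :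
    α.comp (twist m r) = γ := by
  have hl : ∀ p, Linked α (twist m r) (upper p) (.inl (moveBottom (-r) p)) := by
    rintro (p | p)
    · exact linked_twist_right α r p
    · exact .refl _
  have hs : ∀ p, ∃ s, p = moveBottom (-r) s := by
    rintro (p | p)
    · exact ⟨.inl (p + r), by simp [moveBottom]⟩
    · exact ⟨.inr p, rfl⟩
  refine AffineDiagram.comp_eq fun p => ?_
  obtain ⟨p, rfl⟩ := hs p
  rw [h]
  exact .trans _ _ _ (.symm _ _ (hl p)) (.trans _ _ _ (linked_upper _ _ p) (hl _))

end General

theorem twist_comp_capAt (r a : ℤ) : (twist 3 r).comp (capAt a) = capAt (a + r) := by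
  refine twist_comp_eq ?_
  rintro (p | p)
  · simp only [moveTop, capAt_inl]; congr 1; ring
  · obtain ⟨i, h | h | h⟩ := exists_residue_three a p
    · rw [capAt_through h]; exact capAt_through (by omega)
    · rw [capAt_right h]
      exact (capAt_right (i := i) (by omega)).trans (by simp only [moveTop]; congr 1; ring)
    · rw [capAt_left h]
      exact (capAt_left (i := i) (by omega)).trans (by simp only [moveTop]; congr 1; ring)

/-- With a single bottom point, `τ_1` is a full turn of the cylinder, and a full turn moves the top
points by 3. This is the origin of the relation `w = z ^ 3`. -/
theorem capAt_comp_twist (a r : ℤ) : (capAt a).comp (twist 1 r) = capAt (a + 3 * r) := by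
  refine comp_twist_eq ?_
  rintro (p | p)
  · simp only [moveBottom, capAt_inl]; congr 1; ring
  · obtain ⟨i, h | h | h⟩ := exists_residue_three a p
    · rw [capAt_through h]; exact capAt_through (by omega)
    · rw [capAt_right h]
      exact capAt_right (i := i - r) (by omega)
    · rw [capAt_left h]
      exact capAt_left (i := i - r) (by omega)

theorem cupAt_comp_twist (b r : ℤ) : (cupAt b).comp (twist 3 r) = cupAt (b - r) := by
  refine comp_twist_eq ?_
  rintro (p | p)
  · obtain ⟨i, h | h | h⟩ := exists_residue_three b p
    · rw [cupAt_through h]; exact cupAt_through (by omega)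
    · rw [cupAt_right h]
      exact (cupAt_right (i := i) (by omega)).trans (by simp only [moveBottom]; congr 1; ring)
    · rw [cupAt_left h]
      exact (cupAt_left (i := i) (by omega)).trans (by simp only [moveBottom]; congr 1; ring)
  · simp only [moveBottom, cupAt_inr]; congr 1; ring

theorem twist_comp_cupAt (r b : ℤ) : (twist 1 r).comp (cupAt b) = cupAt (b - 3 * r) := by
  refine twist_comp_eq ?_
  rintro (p | p)
  · obtain ⟨i, h | h | h⟩ := exists_residue_three b p
    · rw [cupAt_through h]; exact cupAt_through (by omega)
    · rw [cupAt_right h]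
      exact cupAt_right (i := i + r) (by omega)
    · rw [cupAt_left h]
      exact cupAt_left (i := i + r) (by omega)
  · simp only [moveTop, cupAt_inr]; congr 1; ring

theorem AffineDiagram.comp_eq_twist_one {α : AffineDiagram 3 1} {β : AffineDiagram 1 3} {r : ℤ}
    (h : ∀ i, Linked α β (.inl (.inl i)) (.inl (.inr (i + r)))) : α.comp β = twist 1 r := by
  refine AffineDiagram.comp_eq ?_
  rintro (i | i)
  · exact h i
  · have := h (i - r)
    rw [sub_add_cancel] at this
    exact .symm _ _ this

/-! ### Gluing a cup to a cap. -/

section Pairing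

variable (a b : ℤ)

theorem linked_cup_cap_bottom (i : ℤ) :
    Linked (cupAt b) (capAt a) (.inl (.inl i)) (.inr (3 * i + a)) :=
  linked_lower _ _ (.inl i)

theorem linked_cup_cap_top (i : ℤ) :
    Linked (cupAt b) (capAt a) (.inr (3 * i + b)) (.inl (.inr i)) :=
  .symm _ _ (linked_upper _ _ (.inr i))

theorem linked_cup_cap_cap {i j : ℤ} (h : j = 3 * i + a + 1) :
    Linked (cupAt b) (capAt a) (.inr j) (.inr (j + 1)) := by
  have := linked_lower (cupAt b) (capAt a) (.inr j)
  rwa [capAt_right h] at this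

theorem linked_cup_cap_cup {i j : ℤ} (h : j = 3 * i + b + 1) :
    Linked (cupAt b) (capAt a) (.inr j) (.inr (j + 1)) := by
  have := linked_upper (cupAt b) (capAt a) (.inl j)
  rwa [cupAt_right h] at this

end Pairing

theorem cupAt_comp_capAt_self : (cupAt 0).comp (capAt 0) = twist 1 0 :=
  AffineDiagram.comp_eq_twist_one fun i => by
    rw [add_zero]
    exact .trans _ _ _ (linked_cup_cap_bottom _ _ i) (linked_cup_cap_top _ _ i)

/-- Inner points divisible by 3 lie on the through arc. The other inner points are paired in the
same way from above and from below, and all these pairs are translates of one closed curve. -/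
theorem loops_cupAt_capAt_self : loops (cupAt 0) (capAt 0) = 1 := by
  have hinv : ∀ u v, JoinedOnCylinder (cupAt 0) (capAt 0) u v →
      ((∃ j : ℤ, u = .inr j ∧ j % 3 ≠ 0) ↔ ∃ j : ℤ, v = .inr j ∧ j % 3 ≠ 0) := by
    have key : ∀ u v, Joined (cupAt 0) (capAt 0) u v → (∃ j : ℤ, u = .inr j ∧ j % 3 ≠ 0) →
        ∃ j : ℤ, v = .inr j ∧ j % 3 ≠ 0 := by
      rintro _ _ (⟨p | p, rfl, rfl⟩ | ⟨p | p, rfl, rfl⟩) ⟨j, hj, h⟩ <;>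
        simp only [upper, lower, Sum.inr.injEq, reduceCtorEq] at hj
      · subst hj
        obtain ⟨i, h1 | h1 | h1⟩ := exists_residue_three 0 p
        · omega
        · rw [cupAt_right h1]; exact ⟨p + 1, rfl, by omega⟩
        · rw [cupAt_left h1]; exact ⟨p - 1, rfl, by omega⟩
      · subst hj
        obtain ⟨i, h1 | h1 | h1⟩ := exists_residue_three 0 p
        · omega
        · rw [capAt_right h1]; exact ⟨p + 1, rfl, by omega⟩
        · rw [capAt_left h1]; exact ⟨p - 1, rfl, by omega⟩
    rintro u v (h | rfl)
    · exact ⟨key _ _ h, key _ _ h.symm⟩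
    · rcases u with p | i
      · simp [gshift]
      · simp [gshift]
  -- Being an inner point off the multiples of 3 is an invariant of curves, so the curve of the
  -- inner point 1 never reaches the boundary.
  set f : Quot (JoinedOnCylinder (cupAt 0) (capAt 0)) → Prop :=
    Quot.lift (fun u => ∃ j : ℤ, u = .inr j ∧ j % 3 ≠ 0) (fun u v h => propext (hinv u v h)) with hf
  rw [loops, Nat.card_eq_one_iff_exists]
  refine ⟨⟨Quot.mk _ (.inr 1), fun p hp => ?_⟩, ?_⟩
  · have h1 : f (Quot.mk _ (.inr 1)) := ⟨1, rfl, by decide⟩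
    rw [hp] at h1
    obtain ⟨j, hj, -⟩ := h1
    simp at hj
  · have hshift : ∀ c : ℤ, Quot.mk (JoinedOnCylinder (cupAt 0) (capAt 0)) (.inr (1 + 3 * c)) =
        Quot.mk _ (.inr 1) := by
      have hstep : ∀ j : ℤ, Quot.mk (JoinedOnCylinder (cupAt 0) (capAt 0)) (.inr j) =
          Quot.mk _ (.inr (j + 3)) := fun j => Quot.sound (Or.inr rfl)
      intro c
      induction c using Int.induction_on with
      | zero => rfl
      | succ c ih => rw [← ih, hstep (1 + 3 * c)]; congr 2
      | pred c ih => rw [← ih, hstep (1 + 3 * (-c - 1))]; congr 2; ring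
    rintro ⟨c, hc⟩
    induction c using Quot.ind with | _ u
    rw [Subtype.mk.injEq]
    rcases u with p | j
    · exact absurd rfl (hc p)
    · obtain ⟨i, h | h | h⟩ := exists_residue_three 0 j
      · refine (hc (.inr i) (Quot.sound (Or.inl (Or.inl ⟨.inl j, rfl, ?_⟩)))).elim
        rw [cupAt_through h]; rfl
      · rw [← hshift i]; congr 2; omega
      · have h2 : Quot.mk (JoinedOnCylinder (cupAt 0) (capAt 0)) (.inr j) =
            Quot.mk _ (.inr (j - 1)) :=
          Quot.sound (Or.inl (Or.inl ⟨.inl j, rfl, by rw [cupAt_left h]; rfl⟩))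
        rw [h2, ← hshift i]; congr 2; omega

/-- The curve from bottom `i` zigzags leftwards through the inner points `3i`, `3i - 1`, `3i - 2`
and leaves at top `i - 1`. It uses up all inner points, so there is no loop and a turn by `-1`
appears. -/
theorem cupAt_one_capAt_linked (i : ℤ) :
    (Linked (cupAt 1) (capAt 0) (.inr (3 * i)) (.inl (.inr (i - 1)))) ∧
    (Linked (cupAt 1) (capAt 0) (.inr (3 * i - 1)) (.inl (.inr (i - 1)))) ∧
    (Linked (cupAt 1) (capAt 0) (.inr (3 * i - 2)) (.inl (.inr (i - 1)))) := by
  have h1 := linked_cup_cap_top 0 1 (i - 1)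
  have h2 := linked_cup_cap_cap 0 1 (i := i - 1) (j := 3 * i - 2) (by ring)
  have h3 := linked_cup_cap_cup 0 1 (i := i - 1) (j := 3 * i - 1) (by ring)
  rw [show 3 * (i - 1) + 1 = 3 * i - 2 by ring] at h1
  rw [show 3 * i - 2 + 1 = 3 * i - 1 by ring] at h2
  rw [show 3 * i - 1 + 1 = 3 * i by ring] at h3
  have h4 := Relation.EqvGen.trans _ _ _ (.symm _ _ h2) h1
  exact ⟨.trans _ _ _ (.symm _ _ h3) h4, h4, h1⟩

theorem cupAt_one_comp_capAt : (cupAt 1).comp (capAt 0) = twist 1 (-1) :=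
  AffineDiagram.comp_eq_twist_one fun i => by
    have h := linked_cup_cap_bottom 0 1 i
    rw [add_zero] at h
    exact .trans _ _ _ h (cupAt_one_capAt_linked i).1

theorem loops_cupAt_one_capAt : loops (cupAt 1) (capAt 0) = 0 := by
  refine loops_eq_zero fun j => ?_
  obtain ⟨i, rfl | rfl | rfl⟩ : ∃ i, j = 3 * i ∨ j = 3 * i - 1 ∨ j = 3 * i - 2 :=
    ⟨(j + 2) / 3, by omega⟩
  · exact ⟨_, (cupAt_one_capAt_linked i).1⟩
  · exact ⟨_, (cupAt_one_capAt_linked i).2.1⟩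
  · exact ⟨_, (cupAt_one_capAt_linked i).2.2⟩

/-- Here the zigzag goes rightwards through `3i`, `3i + 1`, `3i + 2` and leaves at top `i`: again no
loop, and this time no turn. -/
theorem cupAt_two_capAt_linked (i : ℤ) :
    (Linked (cupAt 2) (capAt 0) (.inr (3 * i)) (.inl (.inr i))) ∧
    (Linked (cupAt 2) (capAt 0) (.inr (3 * i + 1)) (.inl (.inr i))) ∧
    (Linked (cupAt 2) (capAt 0) (.inr (3 * i + 2)) (.inl (.inr i))) := by
  have h1 := linked_cup_cap_top 0 2 i
  have h2 := linked_cup_cap_cap 0 2 (i := i) (j := 3 * i + 1) (by ring)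
  have h3 := linked_cup_cap_cup 0 2 (i := i - 1) (j := 3 * i) (by ring)
  rw [show 3 * i + 1 + 1 = 3 * i + 2 by ring] at h2
  have h4 := Relation.EqvGen.trans _ _ _ h2 h1
  exact ⟨.trans _ _ _ h3 h4, h4, h1⟩

theorem cupAt_two_comp_capAt : (cupAt 2).comp (capAt 0) = twist 1 0 :=
  AffineDiagram.comp_eq_twist_one fun i => by
    have h := linked_cup_cap_bottom 0 2 i
    rw [add_zero] at h
    rw [add_zero]
    exact .trans _ _ _ h (cupAt_two_capAt_linked i).1

theorem loops_cupAt_two_capAt : loops (cupAt 2) (capAt 0) = 0 := by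
  refine loops_eq_zero fun j => ?_
  obtain ⟨i, rfl | rfl | rfl⟩ := exists_residue_three 0 j
  · exact ⟨_, by simpa using (cupAt_two_capAt_linked i).1⟩
  · exact ⟨_, by simpa using (cupAt_two_capAt_linked i).2.1⟩
  · exact ⟨_, by simpa using (cupAt_two_capAt_linked i).2.2⟩

theorem loops_capAt_cupAt (a b : ℤ) : loops (capAt a) (cupAt b) = 0 :=
  loops_eq_zero fun i => ⟨_, linked_upper (capAt a) (cupAt b) (.inl i)⟩

/-! ### Classification of the diagrams with one through arc. -/

/-- The `c`-th power of the deck transformation. -/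
def turn (m n : ℕ) (c : ℤ) : Pt → Pt
  | .inl i => .inl (m * c + i)
  | .inr j => .inr (n * c + j)

theorem AffineDiagram.arc_turn {m n : ℕ} (α : AffineDiagram m n) (c : ℤ) (p : Pt) :
    α.arc (turn m n c p) = turn m n c (α.arc p) := by
  have hz : ∀ p, turn m n 0 p = p := by rintro (p | p) <;> simp [turn]
  have hs : ∀ (c : ℤ) p, turn m n (c + 1) p = shift m n (turn m n c p) := by
    rintro c (p | p) <;> simp only [turn, shift] <;> congr 1 <;> ring
  induction c using Int.induction_on with
  | zero => rw [hz, hz]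
  | succ c ih => rw [hs, hs, α.arc_shift, ih]
  | pred c ih =>
    refine shift_injective (m := m) (n := n) ?_
    rwa [← α.arc_shift, ← hs, ← hs, sub_add_cancel]

/-- All bottom points are translates of each other. An arc from `i` to `j`, translated by `j - i`,
joins `j` to `2j - i`; but `j` is already joined to `i`, whence `i = j`. -/
theorem monic_of_one {n : ℕ} (β : AffineDiagram 1 n) : β.Monic := by
  intro i
  rcases h : β.arc (.inl i) with j | j
  · exfalso
    have h1 := β.arc_turn (j - i) (.inl i)
    rw [h] at h1
    simp only [turn, Nat.cast_one, one_mul, sub_add_cancel] at h1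
    have h2 := congrArg β.arc h
    rw [β.arc_arc, h1, Sum.inl.injEq] at h2
    refine β.arc_ne (.inl i) ?_
    rw [h]
    congr 1; omega
  · exact ⟨j, rfl⟩

/-- The through arcs occupy the top points congruent to `a` modulo 3. Between two consecutive ones
only two points remain, and noncrossing forces these to be joined. -/
theorem exists_capAt (β : AffineDiagram 1 3) : ∃ a, β = capAt a := by
  obtain ⟨a, ha⟩ := monic_of_one β 0
  have hs : ∀ i : ℤ, ∀ p q : ℤ, β.arc (.inr p) = .inr q →
      β.arc (.inr (3 * i + p)) = .inr (3 * i + q) := by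
    intro i p q h
    have h1 := β.arc_turn i (.inr p)
    rwa [h] at h1
  have hl : ∀ i : ℤ, β.arc (.inl i) = .inr (3 * i + a) := by
    intro i
    have h1 := β.arc_turn i (.inl 0)
    rw [ha] at h1
    simpa [turn] using h1
  have hr : ∀ i : ℤ, β.arc (.inr (3 * i + a)) = .inl i := fun i => by rw [← hl, β.arc_arc]
  have h1 : β.arc (.inr (a + 1)) = .inr (a + 2) := by
    rcases h : β.arc (.inr (a + 1)) with c | c
    · exfalso
      have h2 := congrArg β.arc h
      rw [β.arc_arc, hl, Sum.inr.injEq] at h2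
      omega
    · have h4 := hr 1
      have h5 := hr 0
      have h6 := congrArg β.arc h
      rw [β.arc_arc] at h6
      rw [mul_one] at h4
      rw [mul_zero, zero_add] at h5
      -- Noncrossing with the through arcs at `a` and `a + 3`, used for both orders of the ends of
      -- the arc, confines `c` strictly between them; hence `c = a + 2`.
      have h7 := β.noncrossing (.inl 0) (.inr (a + 1))
      have h8 := β.noncrossing (.inl 1) (.inr c)
      rw [hl, h] at h7
      rw [hl, ← h6] at h8
      have h9 : c ≠ a + 1 := fun e => β.arc_ne (.inr (a + 1)) (by rw [h, e])
      have h10 : c ≠ a := fun e => by rw [e, h5] at h6; simp at h6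
      have h11 : c ≠ a + 3 := fun e => by rw [e, add_comm a 3, h4] at h6; simp at h6
      have h12 := β.noncrossing (.inl 0) (.inr c)
      have h13 := β.noncrossing (.inl 1) (.inr (a + 1))
      rw [hl, ← h6] at h12
      rw [hl, h] at h13
      simp only [Before, true_and] at h7 h8 h12 h13
      congr 1; omega
  have h2 : β.arc (.inr (a + 2)) = .inr (a + 1) := by rw [← h1, β.arc_arc]
  refine ⟨a, ?_⟩
  ext1
  funext p
  rcases p with p | p
  · exact hl p
  · obtain ⟨i, h | h | h⟩ := exists_residue_three a p
    · rw [capAt_through h, h, hr]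
    · rw [capAt_right h, h, add_assoc, hs _ _ _ h1]; congr 1; ring
    · rw [capAt_left h, h, add_assoc, hs _ _ _ h2]; congr 1; ring

/-- An innermost bottom arc joins neighbours. The induction is on the number `d` of points under an
arc: the point next to its left end is joined to another point under the arc, which gives a shorter
arc. -/
theorem exists_adjacent_arc {m n : ℕ} {α : AffineDiagram m n} (h : ¬ α.Monic) :
    ∃ i : ℤ, α.arc (.inl i) = .inl (i + 1) := by
  have key : ∀ (d : ℕ) (i : ℤ), α.arc (.inl i) = .inl (i + 1 + d) →
      ∃ i : ℤ, α.arc (.inl i) = .inl (i + 1) := by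
    intro d
    induction d using Nat.strong_induction_on with
    | _ d ih =>
      intro i hi
      rcases Nat.eq_zero_or_pos d with rfl | hd
      · exact ⟨i, by simpa using hi⟩
      · have h1 := α.noncrossing (.inl i) (.inl (i + 1))
        rw [hi] at h1
        rcases hc : α.arc (.inl (i + 1)) with c | c
        · rw [hc] at h1
          simp only [Before] at h1
          have h2 := congrArg α.arc hi
          have h3 := congrArg α.arc hc
          have h4 := α.arc_ne (.inl (i + 1))
          rw [α.arc_arc] at h2 h3
          have h5 : c ≠ i + 1 + d := by
            rintro rfl
            rw [← h3, Sum.inl.injEq] at h2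
            omega
          have h6 : c ≠ i + 1 := by
            rintro rfl
            exact h4 hc
          have h7 : i < c := by
            by_contra hlt
            have h8 : c ≠ i := by
              rintro rfl
              rw [hi, Sum.inl.injEq] at h3
              omega
            have h9 := α.noncrossing (.inl c) (.inl i)
            rw [← h3, hi] at h9
            simp only [Before] at h9
            omega
          refine ih (c - (i + 2)).toNat (by omega) (i + 1) ?_
          rw [hc]
          congr 1; omega
        · rw [hc] at h1
          simp only [Before, and_true] at h1
          omega
  rw [AffineDiagram.Monic] at h
  push Not at h
  obtain ⟨i, hi⟩ := h
  rcases hj : α.arc (.inl i) with j | j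
  · have hne : j ≠ i := by
      rintro rfl
      exact α.arc_ne _ hj
    rcases lt_or_gt_of_ne hne with hlt | hlt
    · have h2 := congrArg α.arc hj
      rw [α.arc_arc] at h2
      refine key (i - j - 1).toNat j ?_
      rw [← h2]
      congr 1; omega
    · refine key (j - i - 1).toNat i ?_
      rw [hj]
      congr 1; omega
  · exact absurd hj (hi j)

/-- A diagram with an arc between the bottom points `i` and `i + 1` is not changed by the diagram
that pulls the neighbouring point through this arc. -/
theorem comp_capAt_comp_cupAt {α : AffineDiagram 3 3} {i : ℤ}
    (h : α.arc (.inl i) = .inl (i + 1)) : (α.comp (capAt (i - 3))).comp (cupAt (i - 1)) = α := by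
  rw [AffineDiagram.comp_assoc]
  -- Modulo translation by 3, `γ` has the bottom arc `i, i + 1`, the top arc `i + 1, i + 2`, and a
  -- through arc from bottom `i + 2` to top `i`. The offset `i - 3` makes the through arc go to `i`
  -- itself and not to a translate, so that no turn is introduced.
  set γ := (capAt (i - 3)).comp (cupAt (i - 1)) with hγ
  have hb : ∀ c j : ℤ, j = 3 * c + i → γ.arc (.inl j) = .inl (j + 1) := by
    intro c j hj
    refine partner_eq (by simp) ?_
    have h1 := linked_lower (capAt (i - 3)) (cupAt (i - 1)) (.inl j)
    rwa [cupAt_right (i := c) (by omega)] at h1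
  have ht : ∀ c j : ℤ, j = 3 * c + i + 1 → γ.arc (.inr j) = .inr (j + 1) := by
    intro c j hj
    refine partner_eq (by simp) ?_
    have h1 := linked_upper (capAt (i - 3)) (cupAt (i - 1)) (.inr j)
    rwa [capAt_right (i := c + 1) (by omega)] at h1
  have hc : ∀ c j : ℤ, j = 3 * c + i + 2 → γ.arc (.inl j) = .inr (j - 2) := by
    intro c j hj
    refine partner_eq (by simp) ?_
    have h1 := linked_lower (capAt (i - 3)) (cupAt (i - 1)) (.inl j)
    have h2 := linked_upper (capAt (i - 3)) (cupAt (i - 1)) (.inl (c + 1))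
    rw [cupAt_through (i := c + 1) (by omega)] at h1
    rw [capAt_inl, show 3 * (c + 1) + (i - 3) = j - 2 by omega] at h2
    exact .trans _ _ _ h1 h2
  have hα : ∀ c j : ℤ, j = 3 * c + i → α.arc (.inl j) = .inl (j + 1) := by
    intro c j hj
    have h1 := α.arc_turn c (.inl i)
    rw [h] at h1
    simp only [turn] at h1
    rw [hj, add_assoc]
    exact h1
  have hα' : ∀ c j : ℤ, j = 3 * c + i + 1 → α.arc (.inl j) = .inl (j - 1) := by
    intro c j hj
    have h1 := congrArg α.arc (hα c (j - 1) (by omega))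
    rw [α.arc_arc, sub_add_cancel] at h1
    exact h1.symm
  -- The curve from bottom `j` follows the through arc of `γ` to `j - 2`, the arc of `α` to `j - 1`,
  -- and the top arc of `γ` back to `j`.
  have hl : ∀ c j : ℤ, j = 3 * c + i + 2 → Linked α γ (.inl (.inl j)) (.inr j) := by
    intro c j hj
    have h1 := linked_lower α γ (.inl j)
    have h2 := linked_upper α γ (.inl (j - 2))
    have h3 := linked_lower α γ (.inr (j - 1))
    rw [hc c j hj] at h1
    rw [hα c _ (by omega), show j - 2 + 1 = j - 1 by ring] at h2
    rw [ht c _ (by omega), show j - 1 + 1 = j by ring] at h3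
    exact .trans _ _ _ h1 (.trans _ _ _ h2 h3)
  have hu : ∀ p, (∀ c : ℤ, p ≠ .inl (3 * c + i) ∧ p ≠ .inl (3 * c + i + 1)) →
      Linked α γ (.inl p) (upper p) := by
    rintro (j | j) hp
    · obtain ⟨c, hj | hj | hj⟩ := exists_residue_three i j
      · exact absurd (congrArg _ hj) (hp c).1
      · exact absurd (congrArg _ hj) (hp c).2
      · exact hl c j hj
    · exact .refl _
  refine AffineDiagram.comp_eq fun p => ?_
  by_cases hp : ∀ c : ℤ, p ≠ .inl (3 * c + i) ∧ p ≠ .inl (3 * c + i + 1)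
  · refine .trans _ _ _ (hu p hp) (.trans _ _ _ (linked_upper _ _ p) (.symm _ _ (hu _ ?_)))
    intro c
    constructor
    · intro e
      refine (hp c).2 ?_
      rw [← α.arc_arc p, e, hα c _ rfl]
    · intro e
      refine (hp c).1 ?_
      rw [← α.arc_arc p, e, hα' c _ rfl, add_sub_cancel_right]
  · push Not at hp
    obtain ⟨c, hp⟩ := hp
    by_cases e : p = .inl (3 * c + i)
    · subst e
      have h1 := linked_lower α γ (.inl (3 * c + i))
      rw [hb c _ rfl] at h1
      rw [hα c _ rfl]
      exact h1
    · obtain rfl := hp e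
      have h1 := linked_lower α γ (.inl (3 * c + i))
      rw [hb c _ rfl] at h1
      rw [hα' c _ rfl, add_sub_cancel_right]
      exact .symm _ _ h1

/-- An adjacent bottom arc lets `α` factor through a single strand. The upper factor has one bottom
point, so it is a cap by the classification. -/
theorem exists_capAt_comp_cupAt {α : AffineDiagram 3 3} (h : ¬ α.Monic) :
    ∃ a b, α = (capAt a).comp (cupAt b) := by
  obtain ⟨i, hi⟩ := exists_adjacent_arc h
  obtain ⟨a, ha⟩ := exists_capAt (α.comp (capAt (i - 3)))
  exact ⟨a, i - 1, by rw [← ha, comp_capAt_comp_cupAt hi]⟩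

theorem capAt_comp_cupAt_not_monic (a b : ℤ) : ¬ ((capAt a).comp (cupAt b)).Monic := by
  intro h
  obtain ⟨j, hj⟩ := h (b + 1)
  have h1 := linked_lower (capAt a) (cupAt b) (.inl (b + 1))
  rw [cupAt_right (i := 0) (by ring)] at h1
  have h2 : partner (capAt a) (cupAt b) (.inl (b + 1)) = .inl (b + 1 + 1) :=
    partner_eq (by simp) h1
  rw [show ((capAt a).comp (cupAt b)).arc = partner (capAt a) (cupAt b) from rfl, h2] at hj
  simp at hj

end Diagrams

end AffineTL

namespace AffineTL

/-! ### Laurent polynomials, their splitting by exponents modulo 3, and evaluation. -/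

section Laurent

open LaurentPolynomial

variable {V : Type*} [AddCommGroup V] [Module ℂ V]

theorem laurent_ext {f g : ℂ[T;T⁻¹] →ₗ[ℂ] V} (h : ∀ n, f (T n) = g (T n)) (F : ℂ[T;T⁻¹]) :
    f F = g F := by
  induction F using AddMonoidAlgebra.induction_linear with
  | zero => simp
  | add x y hx hy => simp [hx, hy]
  | single r a => rw [single_eq_C_mul_T, ← smul_eq_C_mul, map_smul, map_smul, h]

theorem laurent_ext₂ {f g : ℂ[T;T⁻¹] →ₗ[ℂ] ℂ[T;T⁻¹] →ₗ[ℂ] V}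
    (h : ∀ m n, f (T m) (T n) = g (T m) (T n)) (F G : ℂ[T;T⁻¹]) : f F G = g F G := by
  rw [laurent_ext (f := f) (g := g) fun m => LinearMap.ext (laurent_ext (h m))]

/-- The linear map with the given values at the powers of `T`. -/
noncomputable def onPowers (φ : ℤ → V) : ℂ[T;T⁻¹] →ₗ[ℂ] V :=
  (Finsupp.linearCombination ℂ φ).comp
    (AddMonoidAlgebra.coeffLinearEquiv ℂ : ℂ[T;T⁻¹] ≃ₗ[ℂ] _).toLinearMap

theorem onPowers_T (φ : ℤ → V) (n : ℤ) : onPowers φ (T n) = φ n := by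
  have h : onPowers φ (T n) = Finsupp.linearCombination ℂ φ (Finsupp.single n 1) := rfl
  rw [h, Finsupp.linearCombination_single, one_smul]

/-- The substitution `T ↦ T ^ 3`. -/
noncomputable def cube : ℂ[T;T⁻¹] →ₐ[ℂ] ℂ[T;T⁻¹] :=
  AddMonoidAlgebra.mapDomainAlgHom ℂ ℂ (AddMonoidHom.mulLeft (3 : ℤ))

theorem cube_T (n : ℤ) : cube (T n) = T (3 * n) :=
  AddMonoidAlgebra.mapDomain_single

/-- The terms `T ^ (3 n)`, as a Laurent polynomial in `T ^ 3`. -/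
noncomputable def third : ℂ[T;T⁻¹] →ₗ[ℂ] ℂ[T;T⁻¹] :=
  onPowers fun n => if n % 3 = 0 then T (n / 3) else 0

theorem third_T (n : ℤ) : third (T n) = if n % 3 = 0 then T (n / 3) else 0 := onPowers_T _ n

/-- Multiplication by powers of `T ^ 3` preserves exponents modulo 3, so taking the part with
exponents divisible by 3 is linear over the subring of polynomials in `T ^ 3`. -/
theorem third_cube_mul (F G : ℂ[T;T⁻¹]) : third (cube F * G) = F * third G := by
  have h := laurent_ext₂ (f := ((LinearMap.mul ℂ ℂ[T;T⁻¹]).compr₂ third).comp cube.toLinearMap)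
    (g := (LinearMap.mul ℂ ℂ[T;T⁻¹]).compl₂ third) (fun m n => ?_) F G
  · simpa only [LinearMap.comp_apply, LinearMap.compr₂_apply, LinearMap.compl₂_apply,
      LinearMap.mul_apply', AlgHom.toLinearMap_apply] using h
  · simp only [LinearMap.comp_apply, LinearMap.compr₂_apply, LinearMap.compl₂_apply,
      LinearMap.mul_apply', AlgHom.toLinearMap_apply]
    rw [cube_T, ← T_add, third_T, third_T]
    by_cases h : n % 3 = 0
    · rw [if_pos h, if_pos (by omega), ← T_add]
      congr 1; omega
    · rw [if_neg h, if_neg (by omega), mul_zero]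

/-- A Laurent polynomial is the sum of its parts with exponents `0`, `1`, `2` modulo `3`. -/
theorem sum_T_mul_cube_third (F : ℂ[T;T⁻¹]) :
    ∑ i ∈ Finset.range 3, T (i : ℤ) * cube (third (T (-(i : ℤ)) * F)) = F := by
  have h := laurent_ext (f := ∑ i ∈ Finset.range 3, (LinearMap.mulLeft ℂ (T (i : ℤ))).comp
    (cube.toLinearMap.comp (third.comp (LinearMap.mulLeft ℂ (T (-(i : ℤ)))))))
    (g := LinearMap.id) (fun n => ?_) F
  · simpa using h
  · simp only [Finset.sum_range_succ, Finset.sum_range_zero, LinearMap.add_apply,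
      LinearMap.zero_apply, LinearMap.comp_apply, LinearMap.mulLeft_apply, LinearMap.id_apply,
      AlgHom.toLinearMap_apply, ← T_add, third_T]
    obtain ⟨i, rfl | rfl | rfl⟩ := exists_residue_three 0 n
    all_goals
      split_ifs <;> (try simp only [map_zero, cube_T, mul_zero, zero_add, add_zero, ← T_add]) <;>
        first | omega | (congr 1; push_cast; omega)

theorem sum_T_neg_mul_cube_third (F : ℂ[T;T⁻¹]) :
    ∑ i ∈ Finset.range 3, T (-(i : ℤ)) * cube (third (T (i : ℤ) * F)) = F := by
  have h := laurent_ext (f := ∑ i ∈ Finset.range 3, (LinearMap.mulLeft ℂ (T (-(i : ℤ)))).comp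
    (cube.toLinearMap.comp (third.comp (LinearMap.mulLeft ℂ (T (i : ℤ))))))
    (g := LinearMap.id) (fun n => ?_) F
  · simpa using h
  · simp only [Finset.sum_range_succ, Finset.sum_range_zero, LinearMap.add_apply,
      LinearMap.zero_apply, LinearMap.comp_apply, LinearMap.mulLeft_apply, LinearMap.id_apply,
      AlgHom.toLinearMap_apply, ← T_add, third_T]
    obtain ⟨i, rfl | rfl | rfl⟩ := exists_residue_three 0 n
    all_goals
      split_ifs <;> (try simp only [map_zero, cube_T, mul_zero, zero_add, add_zero, ← T_add]) <;>
        first | omega | (congr 1; push_cast; omega)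

/-- The evaluation at `z`. -/
noncomputable abbrev evalAt (z : ℂˣ) : ℂ[T;T⁻¹] →+* ℂ := eval₂ (RingHom.id ℂ) z

theorem evalAt_smul (z : ℂˣ) (c : ℂ) (F : ℂ[T;T⁻¹]) : evalAt z (c • F) = c * evalAt z F := by
  rw [smul_eq_C_mul, map_mul, eval₂_C, RingHom.id_apply]

theorem evalAt_cube (z : ℂˣ) (F : ℂ[T;T⁻¹]) : evalAt z (cube F) = evalAt (z ^ 3) F := by
  induction F using AddMonoidAlgebra.induction_linear with
  | zero => simp
  | add x y hx hy => simp [hx, hy]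
  | single r a =>
    rw [single_eq_C_mul_T, ← smul_eq_C_mul, map_smul, evalAt_smul, evalAt_smul, cube_T, eval₂_T,
      eval₂_T, zpow_mul]
    norm_cast

end Laurent

/-! ### Caps and cups as rank-one modules, and their pairing. -/

section Cells

open LaurentPolynomial

theorem atTwist_T (k : ℕ) [NeZero k] (n : ℤ) : atTwist k (T n) = Finsupp.single (twist k n) 1 :=
  atTwist_single n 1

/-- `∑ F_r T ^ r ↦ ∑ F_r capAt r`. -/
noncomputable def capSpan : ℂ[T;T⁻¹] →ₗ[ℂ] DiagramSpan 1 3 :=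
  onPowers fun a => Finsupp.single (capAt a) 1

/-- `∑ F_r T ^ r ↦ ∑ F_r cupAt (-r)`. -/
noncomputable def cupSpan : ℂ[T;T⁻¹] →ₗ[ℂ] DiagramSpan 3 1 :=
  onPowers fun b => Finsupp.single (cupAt (-b)) 1

theorem capSpan_T (a : ℤ) : capSpan (T a) = Finsupp.single (capAt a) 1 := onPowers_T _ a

theorem cupSpan_T (b : ℤ) : cupSpan (T b) = Finsupp.single (cupAt (-b)) 1 := onPowers_T _ b

theorem exists_capSpan (v : DiagramSpan 1 3) : ∃ F, v = capSpan F := by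
  induction v using Finsupp.induction_linear with
  | zero => exact ⟨0, by simp⟩
  | add x y hx hy =>
    obtain ⟨F, rfl⟩ := hx
    obtain ⟨G, rfl⟩ := hy
    exact ⟨F + G, by rw [map_add]⟩
  | single α c =>
    obtain ⟨a, rfl⟩ := exists_capAt α
    exact ⟨c • T a, by rw [map_smul, capSpan_T, Finsupp.smul_single_one]⟩

theorem capAt_injective : Function.Injective capAt := by
  intro a b h
  have := congrFun (congrArg AffineDiagram.arc h) (.inl 0)
  simpa [capAt_inl] using this

theorem capSpan_injective : Function.Injective capSpan := by
  have h : ∀ F, capSpan F = Finsupp.mapDomain capAt F.coeff := by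
    intro F
    refine laurent_ext (f := capSpan) (g := (Finsupp.lmapDomain ℂ ℂ capAt).comp
      (AddMonoidAlgebra.coeffLinearEquiv ℂ : ℂ[T;T⁻¹] ≃ₗ[ℂ] _).toLinearMap) (fun n => ?_) F
    rw [capSpan_T]
    exact Finsupp.mapDomain_single.symm
  intro F G e
  rw [h, h] at e
  exact AddMonoidAlgebra.coeff_injective (Finsupp.mapDomain_injective capAt_injective e)

theorem fewerThrough_one (n : ℕ) : fewerThrough 1 n = ⊥ := by
  have h : {β : AffineDiagram 1 n | ¬ β.Monic} = ∅ :=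
    Set.eq_empty_of_forall_notMem fun β h => h (monic_of_one β)
  rw [fewerThrough, h, Finsupp.supported_empty]

variable (δ : ℂ)

theorem atTwist_capSpan (F G : ℂ[T;T⁻¹]) :
    compose δ (atTwist 3 F) (capSpan G) = capSpan (F * G) := by
  have h := laurent_ext₂ (f := (compose δ).compl₁₂ (atTwist 3) capSpan)
    (g := (LinearMap.mul ℂ ℂ[T;T⁻¹]).compr₂ capSpan) (fun m n => ?_) F G
  · simpa only [LinearMap.compl₁₂_apply, LinearMap.compr₂_apply, LinearMap.mul_apply'] using h
  · simp only [LinearMap.compl₁₂_apply, LinearMap.compr₂_apply, LinearMap.mul_apply']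
    rw [atTwist_T, capSpan_T, compose_single, twist_comp_capAt, loops_twist_left, ← T_add, capSpan_T]
    simp [add_comm]

theorem capSpan_atTwist (G f : ℂ[T;T⁻¹]) :
    compose δ (capSpan G) (atTwist 1 f) = capSpan (G * cube f) := by
  have h := laurent_ext₂ (f := (compose δ).compl₁₂ capSpan (atTwist 1))
    (g := ((LinearMap.mul ℂ ℂ[T;T⁻¹]).compl₂ cube.toLinearMap).compr₂ capSpan) (fun m n => ?_) G f
  · simpa only [LinearMap.compl₁₂_apply, LinearMap.compr₂_apply, LinearMap.compl₂_apply,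
      LinearMap.mul_apply', AlgHom.toLinearMap_apply] using h
  · simp only [LinearMap.compl₁₂_apply, LinearMap.compr₂_apply, LinearMap.compl₂_apply,
      LinearMap.mul_apply', AlgHom.toLinearMap_apply]
    rw [atTwist_T, capSpan_T, compose_single, capAt_comp_twist, loops_twist_right, cube_T, ← T_add,
      capSpan_T]
    simp

/-- The sign in `cupSpan` is chosen for this formula: `τ_3` on the right lowers the index of a cup,
so indexing by the negative makes it act as multiplication by `T`. -/
theorem cupSpan_atTwist (G F : ℂ[T;T⁻¹]) :
    compose δ (cupSpan G) (atTwist 3 F) = cupSpan (G * F) := by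
  have h := laurent_ext₂ (f := (compose δ).compl₁₂ cupSpan (atTwist 3))
    (g := (LinearMap.mul ℂ ℂ[T;T⁻¹]).compr₂ cupSpan) (fun m n => ?_) G F
  · simpa only [LinearMap.compl₁₂_apply, LinearMap.compr₂_apply, LinearMap.mul_apply'] using h
  · simp only [LinearMap.compl₁₂_apply, LinearMap.compr₂_apply, LinearMap.mul_apply']
    rw [atTwist_T, cupSpan_T, compose_single, cupAt_comp_twist, loops_twist_right, ← T_add, cupSpan_T]
    simp [sub_eq_add_neg, add_comm]

theorem atTwist_cupSpan (f G : ℂ[T;T⁻¹]) :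
    compose δ (atTwist 1 f) (cupSpan G) = cupSpan (cube f * G) := by
  have h := laurent_ext₂ (f := (compose δ).compl₁₂ (atTwist 1) cupSpan)
    (g := ((LinearMap.mul ℂ ℂ[T;T⁻¹]).comp cube.toLinearMap).compr₂ cupSpan) (fun m n => ?_) f G
  · simpa only [LinearMap.comp_apply, LinearMap.compl₁₂_apply, LinearMap.compr₂_apply,
      LinearMap.mul_apply', AlgHom.toLinearMap_apply] using h
  · simp only [LinearMap.comp_apply, LinearMap.compl₁₂_apply, LinearMap.compr₂_apply,
      LinearMap.mul_apply', AlgHom.toLinearMap_apply]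
    rw [atTwist_T, cupSpan_T, compose_single, twist_comp_cupAt, loops_twist_left, cube_T, ← T_add,
      cupSpan_T]
    simp [sub_eq_add_neg, add_comm]

/-- `δ + T ^ 2 + T ^ (-2)`, which describes the pairing of the caps with the cups. -/
noncomputable def gram : ℂ[T;T⁻¹] := C δ + T 2 + T (-2)

/-- Modulo 3 there are three gluings, one for each term of `gram`: the matching cup produces the
loop and the constant `δ`, and the two neighbouring cups produce the zigzags and the terms `T ^
(-2)` and `T ^ 2`. -/
theorem cupSpan_capSpan_one (n : ℤ) :
    compose δ (cupSpan (T n)) (capSpan 1) = atTwist 1 (third (gram δ * T n)) := by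
  have h0 : gram δ * T 0 = δ • T 0 + T 2 + T (-2) := by
    rw [gram, smul_eq_C_mul, T_zero, mul_one, mul_one]
  have h1 : gram δ * T (-1) = δ • T (-1) + T 1 + T (-3) := by
    rw [gram, smul_eq_C_mul, add_mul, add_mul, ← T_add, ← T_add]; rfl
  have h2 : gram δ * T (-2) = δ • T (-2) + T 0 + T (-4) := by
    rw [gram, smul_eq_C_mul, add_mul, add_mul, ← T_add, ← T_add]; rfl
  have base : ∀ i : ℤ, i = 0 ∨ i = -1 ∨ i = -2 →
      compose δ (cupSpan (T i)) (capSpan 1) = atTwist 1 (third (gram δ * T i)) := by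
    rintro i (rfl | rfl | rfl)
    · rw [cupSpan_T, ← T_zero, capSpan_T, compose_single, h0, neg_zero, cupAt_comp_capAt_self, loops_cupAt_capAt_self]
      simp [third_T, atTwist_T, -T_zero]
    · rw [cupSpan_T, ← T_zero, capSpan_T, compose_single, h1, neg_neg, cupAt_one_comp_capAt, loops_cupAt_one_capAt]
      simp [third_T, atTwist_T, -T_zero]
    · rw [cupSpan_T, ← T_zero, capSpan_T, compose_single, h2, neg_neg, cupAt_two_comp_capAt, loops_cupAt_two_capAt]
      simp [third_T, atTwist_T, -T_zero]
  -- The remainders `0, -1, -2` correspond to the cups `cupAt 0`, `cupAt 1`, `cupAt 2` computed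
  -- above; the factor `T ^ (3 * c)` is a power of `τ_1` and passes through the pairing.
  obtain ⟨c, i, rfl, hi⟩ : ∃ c i : ℤ, n = 3 * c + i ∧ (i = 0 ∨ i = -1 ∨ i = -2) :=
    ⟨(n + 2) / 3, n - 3 * ((n + 2) / 3), by omega, by omega⟩
  rw [T_add, ← cube_T, mul_left_comm, third_cube_mul, atTwist_mul δ, ← base i hi, ← compose_assoc,
    atTwist_cupSpan]

/-- The cap of `F` is `F(τ_3)` applied to the base cap. Moving `F(τ_3)` across to the cup leaves the
pairing with the base cap. -/
theorem cupSpan_capSpan (G F : ℂ[T;T⁻¹]) :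
    compose δ (cupSpan G) (capSpan F) = atTwist 1 (third (gram δ * (G * F))) := by
  have h : ∀ H, compose δ (cupSpan H) (capSpan 1) = atTwist 1 (third (gram δ * H)) :=
    laurent_ext (f := ((compose δ).flip (capSpan 1)).comp cupSpan)
      (g := (atTwist 1).comp (third.comp (LinearMap.mulLeft ℂ (gram δ)))) (cupSpan_capSpan_one δ)
  rw [← h, ← cupSpan_atTwist δ, compose_assoc, atTwist_capSpan, mul_one]

end Cells

end AffineTL

namespace AffineTL

/-! ### Central elements: construction from prescribed components, and constraints. -/

section Center

/-- An element of the algebra `T_n(δ)` as a combination of diagrams. -/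
def toSpan {δ : ℂ} {n : ℕ} (f : TL δ n) : DiagramSpan n n := f

/-- A combination of diagrams as an element of the algebra `T_n(δ)`. -/
def ofSpan (δ : ℂ) {n : ℕ} (a : DiagramSpan n n) : TL δ n := a

open LaurentPolynomial

variable (δ : ℂ)

theorem capSpan_cupSpan_T (a b : ℤ) : compose δ (capSpan (T a)) (cupSpan (T b)) =
    Finsupp.single ((capAt a).comp (cupAt (-b))) 1 := by
  rw [capSpan_T, cupSpan_T, compose_single, loops_capAt_cupAt]
  simp

theorem single_eq_of_not_monic {α : AffineDiagram 3 3} (h : ¬ α.Monic) (c : ℂ) :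
    ∃ F G, Finsupp.single α c = compose δ (capSpan F) (cupSpan G) := by
  obtain ⟨a, b, rfl⟩ := exists_capAt_comp_cupAt h
  refine ⟨c • T a, T (-b), ?_⟩
  rw [map_smul, LinearMap.map_smul₂, capSpan_cupSpan_T, neg_neg, Finsupp.smul_single_one]

theorem fewerThrough_three_induction {P : DiagramSpan 3 3 → Prop} (zero : P 0)
    (add : ∀ x y, P x → P y → P (x + y)) (smul : ∀ (c : ℂ) x, P x → P (c • x))
    (mul : ∀ F G, P (compose δ (capSpan F) (cupSpan G))) {a : DiagramSpan 3 3}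
    (ha : a ∈ fewerThrough 3 3) : P a := by
  rw [fewerThrough, Finsupp.supported_eq_span_single] at ha
  induction ha using Submodule.span_induction with
  | zero => exact zero
  | add x y _ _ hx hy => exact add x y hx hy
  | smul c x _ hx => exact smul c x hx
  | mem x hx =>
    obtain ⟨β, hβ, rfl⟩ := hx
    obtain ⟨F, G, h⟩ := single_eq_of_not_monic δ hβ 1
    change P (Finsupp.single β 1)
    rw [h]
    exact mul F G

theorem capSpan_cupSpan_mem (F G : ℂ[T;T⁻¹]) :
    compose δ (capSpan F) (cupSpan G) ∈ fewerThrough 3 3 := by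
  have h := laurent_ext₂ (f := ((compose δ).compl₁₂ capSpan cupSpan).compr₂
    (fewerThrough 3 3).mkQ) (g := 0) (fun m n => ?_) F G
  · rwa [LinearMap.compr₂_apply, LinearMap.compl₁₂_apply, LinearMap.zero_apply,
      LinearMap.zero_apply, Submodule.mkQ_apply, Submodule.Quotient.mk_eq_zero] at h
  · rw [LinearMap.compr₂_apply, LinearMap.compl₁₂_apply, LinearMap.zero_apply,
      LinearMap.zero_apply, Submodule.mkQ_apply, Submodule.Quotient.mk_eq_zero, capSpan_cupSpan_T]
    exact Finsupp.single_mem_supported ℂ _ (capAt_comp_cupAt_not_monic _ _)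

/-- `∑ τ^i h(τ) c u τ^(-i)`, `i = 0, 1, 2`, where `c` is the cap and `u` the cup at `0`. -/
noncomputable def rotationSum (h : ℂ[T;T⁻¹]) : DiagramSpan 3 3 :=
  ∑ i ∈ Finset.range 3, compose δ (capSpan (T (i : ℤ) * h)) (cupSpan (T (-(i : ℤ))))

theorem rotationSum_mem (h : ℂ[T;T⁻¹]) : rotationSum δ h ∈ fewerThrough 3 3 :=
  Submodule.sum_mem _ fun _ _ => capSpan_cupSpan_mem δ _ _

/-- The `i`-th summand extracts the part of `gram * F` with exponents congruent to `i` modulo 3 and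
restores its exponents. The sum therefore recovers all of `gram * F`, multiplied by `h`. -/
theorem rotationSum_capSpan (h F : ℂ[T;T⁻¹]) :
    compose δ (rotationSum δ h) (capSpan F) = capSpan (gram δ * h * F) := by
  rw [rotationSum, map_sum, LinearMap.sum_apply]
  conv_rhs => rw [mul_right_comm, mul_comm, ← sum_T_mul_cube_third (gram δ * F), Finset.mul_sum,
    map_sum]
  refine Finset.sum_congr rfl fun i _ => ?_
  rw [compose_assoc, cupSpan_capSpan, capSpan_atTwist]
  congr 1
  rw [mul_left_comm (gram δ)]
  ring

theorem cupSpan_rotationSum (h G : ℂ[T;T⁻¹]) :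
    compose δ (cupSpan G) (rotationSum δ h) = cupSpan (gram δ * h * G) := by
  rw [rotationSum, map_sum]
  conv_rhs => rw [← sum_T_neg_mul_cube_third (gram δ * h * G), map_sum]
  refine Finset.sum_congr rfl fun i _ => ?_
  rw [← compose_assoc, cupSpan_capSpan, atTwist_cupSpan, mul_comm,
    show gram δ * (G * (T (i : ℤ) * h)) = T (i : ℤ) * (gram δ * h * G) by ring]

/-- Conjugation by `τ_3` permutes the three summands cyclically. The wrap-around is the identity
`e`: a factor `T ^ 3` on the cap is `τ_1` on the middle strand and can be handed to the cup. -/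
theorem rotationSum_commute_atTwist_T (h : ℂ[T;T⁻¹]) :
    compose δ (rotationSum δ h) (atTwist 3 (T 1)) =
      compose δ (atTwist 3 (T 1)) (rotationSum δ h) := by
  have e : compose δ (capSpan (h * T 3)) (cupSpan (T (-2))) =
      compose δ (capSpan h) (cupSpan (T 1)) := by
    rw [show (3 : ℤ) = 3 * 1 by rfl, ← cube_T, ← capSpan_atTwist δ, compose_assoc,
      atTwist_cupSpan, cube_T, ← T_add]
    rfl
  simp only [rotationSum, map_sum, LinearMap.sum_apply, compose_assoc, cupSpan_atTwist,
    ← compose_assoc δ (atTwist 3 (T 1)), atTwist_capSpan]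
  simp only [Finset.sum_range_succ, Finset.sum_range_zero, ← T_add, ← mul_assoc]
  norm_num
  rw [e]
  abel

theorem rotationSum_commute_atTwist (h F : ℂ[T;T⁻¹]) :
    compose δ (rotationSum δ h) (atTwist 3 F) = compose δ (atTwist 3 F) (rotationSum δ h) := by
  set θ := rotationSum δ h with hθ
  have h1 : compose δ θ (atTwist 3 (T 1)) = compose δ (atTwist 3 (T 1)) θ :=
    rotationSum_commute_atTwist_T δ h
  refine laurent_ext (f := (compose δ θ).comp (atTwist 3))
    (g := ((compose δ).flip θ).comp (atTwist 3)) (fun n => ?_) F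
  rw [LinearMap.comp_apply, LinearMap.comp_apply, LinearMap.flip_apply]
  have inv : ∀ a : DiagramSpan 3 3,
      compose δ (atTwist 3 (T 1)) (compose δ (atTwist 3 (T (-1))) a) = a := by
    intro a
    rw [← compose_assoc, ← atTwist_mul, ← T_add, add_neg_cancel, T_zero, atTwist_one, unit_compose]
  have inv' : ∀ a : DiagramSpan 3 3,
      compose δ (atTwist 3 (T (-1))) (compose δ (atTwist 3 (T 1)) a) = a := by
    intro a
    rw [← compose_assoc, ← atTwist_mul, ← T_add, neg_add_cancel, T_zero, atTwist_one, unit_compose]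
  -- An element commuting with `τ_3` commutes with its inverse; induction in both directions then
  -- covers all powers.
  have h2 : compose δ θ (atTwist 3 (T (-1))) = compose δ (atTwist 3 (T (-1))) θ := by
    rw [← inv' (compose δ θ _), ← compose_assoc δ _ θ, ← h1, compose_assoc, ← atTwist_mul, ← T_add,
      add_neg_cancel, T_zero, atTwist_one, compose_unit]
  induction n using Int.induction_on with
  | zero => rw [T_zero, atTwist_one, unit_compose, compose_unit]
  | succ n ih =>
    rw [T_add, atTwist_mul δ, ← compose_assoc, ih, compose_assoc, h1, compose_assoc]
  | pred n ih =>
    rw [sub_eq_add_neg, T_add, atTwist_mul δ, ← compose_assoc, ih, compose_assoc, h2, compose_assoc]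

/-! ### Central elements with prescribed components. -/

section

variable {F h f : ℂ[T;T⁻¹]} (hf : F + gram δ * h = cube f)
include hf

/-- The element acts on caps as multiplication by `F + gram * h`. By hypothesis this is a polynomial
in `T ^ 3`, which is exactly what the right action of `τ_1` can produce. -/
theorem central_capSpan (G : ℂ[T;T⁻¹]) :
    compose δ (atTwist 3 F + rotationSum δ h) (capSpan G) =
      compose δ (capSpan G) (atTwist 1 f) := by
  rw [LinearMap.map_add₂, atTwist_capSpan, rotationSum_capSpan, capSpan_atTwist, ← map_add,
    ← add_mul, hf, mul_comm]

theorem cupSpan_central (G : ℂ[T;T⁻¹]) :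
    compose δ (cupSpan G) (atTwist 3 F + rotationSum δ h) =
      compose δ (atTwist 1 f) (cupSpan G) := by
  rw [map_add, cupSpan_atTwist, cupSpan_rotationSum, atTwist_cupSpan, ← map_add, mul_comm G,
    ← add_mul, hf]

/-- Diagrams with three through arcs are powers of `τ_3`. Any other diagram is a cap times a cup:
the element turns into `f(τ_1)` on the middle strand when pulled through the cap, and turns back
when pulled through the cup. -/
theorem central_commute (b : DiagramSpan 3 3) :
    compose δ (atTwist 3 F + rotationSum δ h) b =
      compose δ b (atTwist 3 F + rotationSum δ h) := by
  induction b using Finsupp.induction_linear with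
  | zero => simp
  | add x y hx hy => rw [map_add, hx, hy, LinearMap.map_add₂]
  | single α c =>
    by_cases hα : α.Monic
    · obtain ⟨r, rfl⟩ := eq_twist_of_monic hα
      rw [← atTwist_single, LinearMap.map_add₂, map_add, rotationSum_commute_atTwist,
        ← atTwist_mul, ← atTwist_mul, mul_comm]
    · obtain ⟨G, H, e⟩ := single_eq_of_not_monic δ hα c
      rw [e, ← compose_assoc, central_capSpan δ hf, compose_assoc, ← cupSpan_central δ hf,
        compose_assoc]

/-- The central elements of `T_3(δ)` that are prescribed by their components. -/
theorem exists_center : ∃ c : CenterT3 δ,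
    component (splits_self δ 3) c = F ∧ component (splits_one_three δ) c = f := by
  have hc : ofSpan δ (atTwist 3 F + rotationSum δ h) ∈ CenterT3 δ :=
    Subalgebra.mem_center_iff.2 fun b => (central_commute δ hf b).symm
  refine ⟨⟨_, hc⟩, ActsAs.unique (splits_self δ 3) (component_spec _ _) ?_,
    ActsAs.unique (splits_one_three δ) (component_spec _ _) ?_⟩
  · intro v
    rw [Submodule.Quotient.eq]
    change compose δ (atTwist 3 F + rotationSum δ h) v - _ ∈ _
    -- Once the element stands on the right of `v`, its difference from `F(τ_3)` is the rotation
    -- sum, which has fewer than three through arcs and vanishes in the quotient.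
    rw [central_commute δ hf, map_add, add_sub_cancel_left]
    exact compose_mem_fewerThrough δ v (rotationSum_mem δ h)
  · intro v
    obtain ⟨G, rfl⟩ := exists_capSpan v
    exact congrArg _ (central_capSpan δ hf G)

end

variable {δ}

/-- Diagrams with one bottom point always have their through arc, so the quotient defining `C_1` is
trivial and the action holds on the nose. -/
theorem center_capSpan (c : CenterT3 δ) (G : ℂ[T;T⁻¹]) :
    compose δ (toSpan (c : TL δ 3)) (capSpan G) =
      capSpan (G * cube (component (splits_one_three δ) c)) := by
  have h : Submodule.Quotient.mk (compose δ (toSpan (c : TL δ 3)) (capSpan G)) =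
      Submodule.Quotient.mk _ := component_spec (splits_one_three δ) c (capSpan G)
  rw [Submodule.Quotient.eq, fewerThrough_one, Submodule.mem_bot, sub_eq_zero] at h
  rw [h, capSpan_atTwist]

theorem center_sub_atTwist_mem (c : CenterT3 δ) :
    (toSpan (c : TL δ 3)) - atTwist 3 (component (splits_self δ 3) c) ∈
      fewerThrough 3 3 := by
  have h : Submodule.Quotient.mk (compose δ (toSpan (c : TL δ 3)) (unitDiagram 3)) =
      Submodule.Quotient.mk _ := component_spec (splits_self δ 3) c (unitDiagram 3)
  rwa [Submodule.Quotient.eq, compose_unit, unit_compose] at h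

/-- At the zeros of the Gram polynomial the two components of a central element agree. -/
theorem evalComponent_eq_of_gram_eq_zero {z : ℂˣ} (hz : evalAt z (gram δ) = 0) (c : CenterT3 δ) :
    evalComponent (splits_self δ 3) z c = evalComponent (splits_one_three δ) (z ^ 3) c := by
  -- A test vector dual to evaluation at `z`: for every `F`, the part of `V * F` with exponents
  -- divisible by 3, evaluated at `z ^ 3`, equals `F(z)`. Each term of `V` is 1 at `z`, so `V(z) =
  -- 3`.
  set V : ℂ[T;T⁻¹] := ∑ i ∈ Finset.range 3, C ((z ^ (-(i : ℤ)) : ℂˣ) : ℂ) * T (i : ℤ) with hV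
  have hthird : ∀ F, evalAt (z ^ 3) (third (V * F)) = evalAt z F := by
    intro F
    conv_rhs => rw [← sum_T_neg_mul_cube_third F, map_sum]
    rw [hV, Finset.sum_mul, map_sum, map_sum]
    refine Finset.sum_congr rfl fun i _ => ?_
    rw [mul_assoc, ← smul_eq_C_mul, map_smul, evalAt_smul, map_mul (evalAt z), evalAt_cube,
      eval₂_T]
  have hVz : evalAt z V = 3 := by
    rw [hV, map_sum, Finset.sum_congr rfl (g := fun _ => (1 : ℂ))]
    · simp
    · intro i _
      rw [map_mul, eval₂_C, eval₂_T, RingHom.id_apply, ← Units.val_mul, ← zpow_add,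
        neg_add_cancel, zpow_zero, Units.val_one]
  -- A cap times a cup sends `V` to a multiple of its pairing with the cup, and at `z` that pairing
  -- has the factor `gram(z) = 0`.
  have hJ : ∀ a ∈ fewerThrough 3 3, ∃ H, compose δ a (capSpan V) = capSpan H ∧ evalAt z H = 0 := by
    intro a ha
    refine fewerThrough_three_induction δ (P := fun a => ∃ H, compose δ a (capSpan V) = capSpan H ∧
      evalAt z H = 0) ⟨0, by simp⟩ ?_ ?_ ?_ ha
    · rintro x y ⟨H, h1, h2⟩ ⟨H', h1', h2'⟩
      exact ⟨H + H', by rw [LinearMap.map_add₂, h1, h1', map_add], by rw [map_add, h2, h2', add_zero]⟩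
    · rintro c x ⟨H, h1, h2⟩
      exact ⟨c • H, by rw [LinearMap.map_smul₂, h1, map_smul], by rw [evalAt_smul, h2, mul_zero]⟩
    · intro F G
      refine ⟨F * cube (third (V * (gram δ * G))), ?_, ?_⟩
      · rw [compose_assoc, cupSpan_capSpan, capSpan_atTwist,
          show gram δ * (G * V) = V * (gram δ * G) by ring]
      · rw [map_mul, evalAt_cube, hthird, map_mul (evalAt z) (gram δ), hz, zero_mul, mul_zero]
  -- Applied to `c - f_3(τ)`, this gives `(f_1(z ^ 3) - f_3(z)) * V(z) = 0`, and `V(z) = 3` can be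
  -- cancelled.
  obtain ⟨H, h1, h2⟩ := hJ _ (center_sub_atTwist_mem c)
  rw [LinearMap.map_sub₂, center_capSpan, atTwist_capSpan, ← map_sub] at h1
  rw [← capSpan_injective h1, map_sub, map_mul, map_mul, evalAt_cube, hVz, mul_comm,
    ← sub_mul, mul_eq_zero, sub_eq_zero] at h2
  exact (h2.resolve_right three_ne_zero).symm

/-- A central element is nilpotent if both components vanish. -/
theorem mul_self_eq_zero_of_components (c : CenterT3 δ)
    (h3 : component (splits_self δ 3) c = 0) (h1 : component (splits_one_three δ) c = 0) :
    c * c = 0 := by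
  -- Since `f_1 = 0`, `c` kills all caps and hence the whole ideal; since `f_3 = 0`, `c` lies in
  -- that ideal.
  have hc : ∀ a ∈ fewerThrough 3 3, compose δ (toSpan (c : TL δ 3)) a = 0 := by
    intro a ha
    refine fewerThrough_three_induction δ
      (P := fun a => compose δ (toSpan (c : TL δ 3)) a = 0) (map_zero _) ?_ ?_ ?_ ha
    · intro x y hx hy
      rw [map_add, hx, hy, add_zero]
    · intro r x hx
      rw [map_smul, hx, smul_zero]
    · intro F G
      rw [← compose_assoc, center_capSpan, h1, map_zero, mul_zero, map_zero, LinearMap.map_zero₂]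
  have h := center_sub_atTwist_mem c
  rw [h3, map_zero, sub_zero] at h
  exact Subtype.ext (hc _ h)

end Center

end AffineTL

namespace AffineTL

/-! ### Maximal ideals, integrality over the centre, and separation of points. -/

section Spectrum

open LaurentPolynomial

/-- By the Nullstellensatz the residue field is `ℂ`. The image of `T` is invertible, with inverse
the image of `T ^ (-1)`, and this unit is the point. -/
theorem exists_evalAt_of_isMaximal (m : Ideal ℂ[T;T⁻¹]) [m.IsMaximal] :
    ∃ z : ℂˣ, ∀ F, F ∈ m ↔ evalAt z F = 0 := by
  let : Field (ℂ[T;T⁻¹] ⧸ m) := Ideal.Quotient.field m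
  have : Module.Finite ℂ (ℂ[T;T⁻¹] ⧸ m) := finite_of_finite_type_of_isJacobsonRing ℂ _
  have hb : Function.Bijective (algebraMap ℂ (ℂ[T;T⁻¹] ⧸ m)) :=
    IsAlgClosed.algebraMap_bijective_of_isIntegral
  obtain ⟨a, ha⟩ := hb.2 (Ideal.Quotient.mk m (T 1))
  obtain ⟨b, hb'⟩ := hb.2 (Ideal.Quotient.mk m (T (-1)))
  have hab : a * b = 1 := by
    refine hb.1 ?_
    rw [map_mul, ha, hb', ← map_mul, ← T_add, add_neg_cancel, T_zero, map_one, map_one]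
  set z : ℂˣ := ⟨a, b, hab, by rw [mul_comm, hab]⟩ with hz
  have hT : ∀ n : ℤ, Ideal.Quotient.mk m (T n) = algebraMap ℂ _ ((z ^ n : ℂˣ) : ℂ) := by
    intro n
    induction n using Int.induction_on with
    | zero => rw [T_zero, map_one, zpow_zero, Units.val_one, map_one]
    | succ n ih => rw [T_add, map_mul, ih, ← ha, ← map_mul, zpow_add_one, Units.val_mul]
    | pred n ih =>
      rw [sub_eq_add_neg, T_add, map_mul, ih, ← hb', ← map_mul, ← sub_eq_add_neg, zpow_sub_one,
        Units.val_mul]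
      rfl
  refine ⟨z, fun F => ?_⟩
  have hF : Ideal.Quotient.mk m F = algebraMap ℂ _ (evalAt z F) := by
    induction F using AddMonoidAlgebra.induction_linear with
    | zero => simp
    | add x y hx hy => rw [map_add, map_add, map_add, hx, hy]
    | single r a =>
      rw [single_eq_C_mul_T, map_mul, map_mul, map_mul, hT, eval₂_T, eval₂_C]
      rfl
  rw [← Ideal.Quotient.eq_zero_iff_mem, hF, map_eq_zero_iff _ hb.1]

theorem exists_evalAt_of_isMaximal_prod (Q : Ideal (ℂ[T;T⁻¹] × ℂ[T;T⁻¹])) [hQ : Q.IsMaximal] :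
    (∃ z : ℂˣ, ∀ r, r ∈ Q ↔ evalAt z r.1 = 0) ∨ ∃ z : ℂˣ, ∀ r, r ∈ Q ↔ evalAt z r.2 = 0 := by
  rcases (Ideal.ideal_prod_prime Q).1 hQ.isPrime with ⟨p, hp, h⟩ | ⟨p, hp, h⟩
  · left
    obtain ⟨m, hm, hpm⟩ := Ideal.exists_le_maximal p hp.ne_top
    obtain ⟨z, hz⟩ := exists_evalAt_of_isMaximal m
    have hle : Q ≤ Ideal.prod m ⊤ := by
      rw [h]
      exact fun r hr => ⟨hpm hr.1, hr.2⟩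
    have hne : Ideal.prod m ⊤ ≠ (⊤ : Ideal (ℂ[T;T⁻¹] × ℂ[T;T⁻¹])) := by
      intro e
      have h1 : (1 : ℂ[T;T⁻¹] × ℂ[T;T⁻¹]) ∈ Ideal.prod m ⊤ := by rw [e]; trivial
      exact hm.ne_top ((Ideal.eq_top_iff_one m).2 h1.1)
    refine ⟨z, fun r => ?_⟩
    rw [hQ.eq_of_le hne hle, ← hz]
    exact ⟨fun hr => hr.1, fun hr => ⟨hr, trivial⟩⟩
  · right
    obtain ⟨m, hm, hpm⟩ := Ideal.exists_le_maximal p hp.ne_top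
    obtain ⟨z, hz⟩ := exists_evalAt_of_isMaximal m
    have hle : Q ≤ Ideal.prod ⊤ m := by
      rw [h]
      exact fun r hr => ⟨hr.1, hpm hr.2⟩
    have hne : Ideal.prod ⊤ m ≠ (⊤ : Ideal (ℂ[T;T⁻¹] × ℂ[T;T⁻¹])) := by
      intro e
      have h1 : (1 : ℂ[T;T⁻¹] × ℂ[T;T⁻¹]) ∈ Ideal.prod ⊤ m := by rw [e]; trivial
      exact hm.ne_top ((Ideal.eq_top_iff_one m).2 h1.2)
    refine ⟨z, fun r => ?_⟩
    rw [hQ.eq_of_le hne hle, ← hz]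
    exact ⟨fun hr => hr.2, fun hr => ⟨trivial, hr⟩⟩

/-- The hypothesis says that a monic polynomial of positive degree takes an integral value at `x`.
The extra factor `x` serves for the product ring, where it kills the other coordinate. -/
theorem isIntegral_of_mul_prod {ι R A : Type*} [Fintype ι] [CommRing R] [CommRing A] [Nontrivial R]
    [Algebra R A] {x : A} (a : ι → R) (h : IsIntegral R (x * ∏ i, (x - algebraMap R A (a i)))) :
    IsIntegral R x := by
  have hm : (∏ i, (Polynomial.X - Polynomial.C (a i))).Monic :=
    Polynomial.monic_prod_of_monic _ _ fun i _ => Polynomial.monic_X_sub_C _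
  refine IsIntegral.of_aeval_monic (p := Polynomial.X * ∏ i, (Polynomial.X - Polynomial.C (a i)))
    (Polynomial.monic_X.mul hm) ?_ ?_
  · rw [Polynomial.monic_X.natDegree_mul hm, Polynomial.natDegree_X]
    omega
  · simpa [map_prod] using h

variable {δ : ℂ}

/-- The equations `∏ (T ^ (± 1) - z_i) = T ^ (± 2) (δ + T ^ 2 + T ^ (-2))`. -/
def GramFactors (δ : ℂ) (z : Fin 4 → ℂˣ) : Prop :=
  ∀ e : ℤ, e = 1 ∨ e = -1 → ∏ i, (T e - C (z i : ℂ)) = T (2 * e) * gram δ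

/-- Factor by factor, `T ^ e - z_i` divides `T ^ (3 * e) - z_i ^ 3`. Working with products over the
index keeps multiplicities right when some `z_i` coincide. -/
theorem gram_dvd_cube {z w : Fin 4 → ℂˣ} (hg : GramFactors δ z) (hw : ∀ i, w i = z i ^ 3) {e : ℤ}
    (he : e = 1 ∨ e = -1) : gram δ ∣ cube (∏ i, (T e - C (w i : ℂ))) := by
  refine (Dvd.intro_left _ (hg e he).symm).trans ?_
  rw [map_prod]
  refine Finset.prod_dvd_prod_of_dvd _ _ fun i _ => ?_
  have h1 : cube (T e - C (w i : ℂ)) = T e ^ 3 - C (z i : ℂ) ^ 3 := by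
    rw [map_sub, cube_T, T_pow, C_eq_algebraMap, AlgHom.commutes, hw, Units.val_pow_eq_pow_val,
      map_pow]
    rfl
  rw [h1]
  exact sub_dvd_pow_sub_pow _ _ 3

section Integral

variable {R : Type*} [CommRing R] [Nontrivial R] [Algebra ℂ R] [Algebra R (ℂ[T;T⁻¹] × ℂ[T;T⁻¹])]
  [IsScalarTower ℂ R (ℂ[T;T⁻¹] × ℂ[T;T⁻¹])]

/-- Products of the four given elements yield all `(T ^ n, 0)` and `(0, T ^ n)`, including the
idempotents as `T * T ^ (-1)`; these span the ring over `ℂ`. -/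
theorem isIntegral_of_generators
    (h3 : ∀ e : ℤ, e = 1 ∨ e = -1 → IsIntegral R ((T e, 0) : ℂ[T;T⁻¹] × ℂ[T;T⁻¹]))
    (h1 : ∀ e : ℤ, e = 1 ∨ e = -1 → IsIntegral R ((0, T e) : ℂ[T;T⁻¹] × ℂ[T;T⁻¹])) :
    Algebra.IsIntegral R (ℂ[T;T⁻¹] × ℂ[T;T⁻¹]) := by
  have hT3 : ∀ n : ℤ, IsIntegral R ((T n, 0) : ℂ[T;T⁻¹] × ℂ[T;T⁻¹]) := by
    intro n
    have hm : ∀ a b : ℤ, ((T a, 0) : ℂ[T;T⁻¹] × ℂ[T;T⁻¹]) * (T b, 0) = (T (a + b), 0) := by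
      intro a b
      rw [Prod.mk_mul_mk, ← T_add, mul_zero]
    induction n using Int.induction_on with
    | zero => simpa only [hm, add_neg_cancel] using (h3 1 (Or.inl rfl)).mul (h3 (-1) (Or.inr rfl))
    | succ n ih => simpa only [hm] using ih.mul (h3 1 (Or.inl rfl))
    | pred n ih => simpa only [hm, sub_eq_add_neg] using ih.mul (h3 (-1) (Or.inr rfl))
  have hT1 : ∀ n : ℤ, IsIntegral R ((0, T n) : ℂ[T;T⁻¹] × ℂ[T;T⁻¹]) := by
    intro n
    have hm : ∀ a b : ℤ, ((0, T a) : ℂ[T;T⁻¹] × ℂ[T;T⁻¹]) * (0, T b) = (0, T (a + b)) := by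
      intro a b
      rw [Prod.mk_mul_mk, ← T_add, mul_zero]
    induction n using Int.induction_on with
    | zero => simpa only [hm, add_neg_cancel] using (h1 1 (Or.inl rfl)).mul (h1 (-1) (Or.inr rfl))
    | succ n ih => simpa only [hm] using ih.mul (h1 1 (Or.inl rfl))
    | pred n ih => simpa only [hm, sub_eq_add_neg] using ih.mul (h1 (-1) (Or.inr rfl))
  have hs : ∀ (c : ℂ) (x : ℂ[T;T⁻¹] × ℂ[T;T⁻¹]), IsIntegral R x → IsIntegral R (c • x) := by
    intro c x hx
    rw [Algebra.smul_def, IsScalarTower.algebraMap_apply ℂ R]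
    exact isIntegral_algebraMap.mul hx
  have hF3 : ∀ F, IsIntegral R ((F, 0) : ℂ[T;T⁻¹] × ℂ[T;T⁻¹]) := by
    intro F
    induction F using AddMonoidAlgebra.induction_linear with
    | zero => exact isIntegral_zero
    | add x y hx hy => simpa using hx.add hy
    | single r a =>
      rw [single_eq_C_mul_T, ← smul_eq_C_mul]
      simpa using hs a _ (hT3 r)
  have hF1 : ∀ F, IsIntegral R ((0, F) : ℂ[T;T⁻¹] × ℂ[T;T⁻¹]) := by
    intro F
    induction F using AddMonoidAlgebra.induction_linear with
    | zero => exact isIntegral_zero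
    | add x y hx hy => simpa using hx.add hy
    | single r a =>
      rw [single_eq_C_mul_T, ← smul_eq_C_mul]
      simpa using hs a _ (hT1 r)
  refine ⟨fun x => ?_⟩
  simpa using (hF3 x.1).add (hF1 x.2)

/-- The ring of admissible pairs contains `(gram * G, 0)` for every `G`, and `(0, f)` whenever
`gram` divides `cube f`. Hence a monic polynomial in each generator, with roots at 0 and at the
glued points, already takes its value in the image of `R`. -/
theorem isIntegral_of_components {z w : Fin 4 → ℂˣ} (hg : GramFactors δ z)
    (hw : ∀ i, w i = z i ^ 3) (hR : ∀ F h f, F + gram δ * h = cube f →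
      ∃ c, algebraMap R (ℂ[T;T⁻¹] × ℂ[T;T⁻¹]) c = (F, f)) :
    Algebra.IsIntegral R (ℂ[T;T⁻¹] × ℂ[T;T⁻¹]) := by
  have hC : ∀ a : ℂ, algebraMap R (ℂ[T;T⁻¹] × ℂ[T;T⁻¹]) (algebraMap ℂ R a) = (C a, C a) := by
    intro a
    rw [← IsScalarTower.algebraMap_apply]
    rfl
  refine isIntegral_of_generators (fun e he => ?_) (fun e he => ?_)
  · refine isIntegral_of_mul_prod (fun i => algebraMap ℂ R (z i)) ?_
    obtain ⟨c, hc⟩ := hR (T e * (T (2 * e) * gram δ)) (-(T e * T (2 * e))) 0 (by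
      rw [map_zero]; ring)
    have h : ((T e, 0) : ℂ[T;T⁻¹] × ℂ[T;T⁻¹]) * ∏ i, ((T e, 0) - algebraMap R _ (algebraMap ℂ R (z i)))
        = algebraMap R _ c := by
      rw [hc, ← hg e he]
      refine Prod.ext ?_ ?_
      · simp [hC, Prod.fst_prod]
      · simp
    rw [h]
    exact isIntegral_algebraMap
  · refine isIntegral_of_mul_prod (fun i => algebraMap ℂ R (w i)) ?_
    obtain ⟨h, hh⟩ := gram_dvd_cube hg hw he
    obtain ⟨c, hc⟩ := hR 0 (cube (T e) * h) (T e * ∏ i, (T e - C (w i : ℂ))) (by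
      rw [map_mul, hh]; ring)
    have h : ((0, T e) : ℂ[T;T⁻¹] × ℂ[T;T⁻¹]) * ∏ i, ((0, T e) - algebraMap R _ (algebraMap ℂ R (w i)))
        = algebraMap R _ c := by
      rw [hc]
      refine Prod.ext ?_ ?_
      · simp
      · simp [hC, Prod.snd_prod]
    rw [h]
    exact isIntegral_algebraMap

end Integral

theorem mem_Psi_inl {z : ℂˣ} {c : CenterT3 δ} :
    c ∈ (Psi δ (.inl z)).asIdeal ↔ evalAt z (component (splits_self δ 3) c) = 0 := Iff.rfl

theorem mem_Psi_inr {w : ℂˣ} {c : CenterT3 δ} :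
    c ∈ (Psi δ (.inr w)).asIdeal ↔ evalAt w (component (splits_one_three δ) c) = 0 := Iff.rfl

theorem Psi_surjective {z w : Fin 4 → ℂˣ} (hg : GramFactors δ z) (hw : ∀ i, w i = z i ^ 3) :
    Function.Surjective (Psi δ) := by
  intro P
  set φ : CenterT3 δ →ₐ[ℂ] ℂ[T;T⁻¹] × ℂ[T;T⁻¹] :=
    (component (splits_self δ 3)).prod (component (splits_one_three δ)) with hφ
  let : Algebra (CenterT3 δ) (ℂ[T;T⁻¹] × ℂ[T;T⁻¹]) := φ.toRingHom.toAlgebra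
  have : IsScalarTower ℂ (CenterT3 δ) (ℂ[T;T⁻¹] × ℂ[T;T⁻¹]) :=
    IsScalarTower.of_algebraMap_eq fun a => (φ.commutes a).symm
  have := P.isMaximal
  have : Nontrivial (CenterT3 δ) := ⟨⟨0, 1, fun h =>
    P.isMaximal.ne_top ((Ideal.eq_top_iff_one _).2 (h ▸ zero_mem _))⟩⟩
  have : Algebra.IsIntegral (CenterT3 δ) (ℂ[T;T⁻¹] × ℂ[T;T⁻¹]) := by
    refine isIntegral_of_components hg hw fun F h f hf => ?_
    obtain ⟨c, h3, h1⟩ := exists_center δ hf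
    exact ⟨c, Prod.ext h3 h1⟩
  -- The components need not determine a central element, but elements of the kernel have square
  -- zero and so lie in every prime. This is what lying over needs for a map that may fail to be
  -- injective.
  have hker : RingHom.ker (algebraMap (CenterT3 δ) (ℂ[T;T⁻¹] × ℂ[T;T⁻¹])) ≤ P.asIdeal := by
    intro c hc
    have h3 : component (splits_self δ 3) c = 0 := congrArg Prod.fst hc
    have h1 : component (splits_one_three δ) c = 0 := congrArg Prod.snd hc
    have h := mul_self_eq_zero_of_components c h3 h1
    exact (or_self_iff.1 (P.isMaximal.isPrime.mem_or_mem (h ▸ zero_mem _)))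
  obtain ⟨Q, hQ, hQP⟩ := Ideal.exists_ideal_over_maximal_of_isIntegral P.asIdeal hker
  have hmem : ∀ c, c ∈ P.asIdeal ↔ φ c ∈ Q := fun c => by rw [← hQP]; rfl
  rcases exists_evalAt_of_isMaximal_prod Q with ⟨x, hx⟩ | ⟨x, hx⟩
  · refine ⟨.inl x, MaximalSpectrum.ext (Ideal.ext fun c => ?_)⟩
    rw [hmem, hx]
    rfl
  · refine ⟨.inr x, MaximalSpectrum.ext (Ideal.ext fun c => ?_)⟩
    rw [hmem, hx]
    rfl

theorem Psi_inl_eq_inr {z : ℂˣ} (hz : evalAt z (gram δ) = 0) :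
    Psi δ (.inl z) = Psi δ (.inr (z ^ 3)) := by
  refine MaximalSpectrum.ext (Ideal.ext fun c => ?_)
  have h := evalComponent_eq_of_gram_eq_zero hz c
  exact ⟨fun hc => h.symm.trans hc, fun hc => h.trans hc⟩

theorem evalAt_T_sub_C (z y : ℂˣ) : evalAt z (T 1 - C (y : ℂ)) = z - y := by
  rw [map_sub, eval₂_T, eval₂_C, zpow_one, RingHom.id_apply]

/-- Separated by the central element with components `(gram * (T - y), 0)`. Only `z` has to avoid
the zeros of `gram`, so `y` may be one of the glued points. -/
theorem Psi_inl_ne_inl {z y : ℂˣ} (hz : evalAt z (gram δ) ≠ 0) (h : z ≠ y) :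
    Psi δ (.inl z) ≠ Psi δ (.inl y) := by
  obtain ⟨c, h3, -⟩ := exists_center δ (F := gram δ * (T 1 - C (y : ℂ))) (h := -(T 1 - C (y : ℂ)))
    (f := 0) (by rw [map_zero]; ring)
  intro e
  have h1 : c ∈ (Psi δ (.inl y)).asIdeal := by
    rw [mem_Psi_inl, h3, map_mul, evalAt_T_sub_C, sub_self, mul_zero]
  rw [← e, mem_Psi_inl, h3, map_mul, evalAt_T_sub_C, mul_eq_zero, sub_eq_zero] at h1
  exact h1.elim hz fun h2 => h (Units.ext h2)

theorem Psi_inl_ne_inr {z : ℂˣ} (hz : evalAt z (gram δ) ≠ 0) (y : ℂˣ) :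
    Psi δ (.inl z) ≠ Psi δ (.inr y) := by
  obtain ⟨c, h3, h1⟩ := exists_center δ (F := gram δ) (h := -1) (f := 0) (by rw [map_zero]; ring)
  intro e
  have h2 : c ∈ (Psi δ (.inr y)).asIdeal := by rw [mem_Psi_inr, h1, map_zero]
  rw [← e, mem_Psi_inl, h3] at h2
  exact hz h2

/-- Separated by the central element with components `(0, ∏ (T - w_i) * (T - y))`, which is
admissible because `gram` divides the cube substitution of the product. Again `y` is unrestricted.
-/
theorem Psi_inr_ne_inr {z w : Fin 4 → ℂˣ} (hg : GramFactors δ z) (hw : ∀ i, w i = z i ^ 3)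
    {x y : ℂˣ} (hx : ∀ i, x ≠ w i) (h : x ≠ y) : Psi δ (.inr x) ≠ Psi δ (.inr y) := by
  obtain ⟨g, hd⟩ := gram_dvd_cube hg hw (Or.inl rfl)
  obtain ⟨c, -, h1⟩ := exists_center δ (F := 0) (h := g * cube (T 1 - C (y : ℂ)))
    (f := (∏ i, (T 1 - C (w i : ℂ))) * (T 1 - C (y : ℂ))) (by rw [map_mul, hd]; ring)
  intro e
  have h2 : c ∈ (Psi δ (.inr y)).asIdeal := by
    rw [mem_Psi_inr, h1, map_mul, evalAt_T_sub_C, sub_self, mul_zero]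
  rw [← e, mem_Psi_inr, h1, map_mul, evalAt_T_sub_C, mul_eq_zero, sub_eq_zero, map_prod,
    Finset.prod_eq_zero_iff] at h2
  rcases h2 with ⟨i, -, h2⟩ | h2
  · rw [evalAt_T_sub_C, sub_eq_zero] at h2
    exact hx i (Units.ext h2)
  · exact h (Units.ext h2)

theorem evalAt_gram_eq_zero_iff {z : Fin 4 → ℂˣ} (hg : GramFactors δ z) (x : ℂˣ) :
    evalAt x (gram δ) = 0 ↔ ∃ i, x = z i := by
  have h := congrArg (evalAt x) (hg 1 (Or.inl rfl))
  rw [map_prod, map_mul, eval₂_T] at h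
  simp only [evalAt_T_sub_C] at h
  rw [← mul_eq_zero_iff_left (Units.ne_zero (x ^ (2 * 1 : ℤ))), ← h, Finset.prod_eq_zero_iff]
  simp [sub_eq_zero, Units.ext_iff]

/-- Both signs of `e` are covered by one computation, since `gram` is invariant under `T ↦ T ^
(-1)`: with `X = T ^ e`, both sides are `(X ^ 2 - s ^ 2) * (X ^ 2 - s ^ (-2))`. -/
theorem gramFactors {q s : ℂˣ} (hs : s ^ 2 = q) (hδ : δ = -(q : ℂ) - (q : ℂ)⁻¹) :
    GramFactors δ ![s, -s, s⁻¹, -s⁻¹] := by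
  intro e he
  have hsc : C (s : ℂ) * C ((s : ℂ)⁻¹) = 1 := by
    rw [← map_mul, mul_inv_cancel₀ s.ne_zero, map_one]
  have hC : C δ = -C (s : ℂ) ^ 2 - C ((s : ℂ)⁻¹) ^ 2 := by
    rw [hδ, ← hs, Units.val_pow_eq_pow_val, ← inv_pow, map_sub, map_neg, map_pow, map_pow]
  have hg : gram δ = C δ + T e ^ 2 + T (-e) ^ 2 := by
    rcases he with rfl | rfl
    · rw [gram, T_pow, T_pow]; norm_num
    · rw [gram, T_pow, T_pow, add_right_comm]; norm_num
  have hT : T (R := ℂ) e * T (-e) = 1 := by rw [← T_add, add_neg_cancel, T_zero]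
  have h2 : T (R := ℂ) (2 * e) = T e ^ 2 := by rw [T_pow]; rfl
  rw [hg, hC, h2, Fin.prod_univ_four]
  simp only [Matrix.cons_val, Units.val_neg, Units.val_inv_eq_inv_val, map_neg]
  -- The two sides differ by `(s * s⁻¹) ^ 2 - (T ^ e * T ^ (-e)) ^ 2`; each square equals 1, which
  -- accounts for the coefficients of the form `u + 1`.
  linear_combination (C (s : ℂ) * C ((s : ℂ)⁻¹) + 1) * hsc - (T e * T (-e) + 1) * hT

end Spectrum

end AffineTL

/-! ### The proposition. -/

theorem mainTheorem9 (q s : ℂˣ) (hs : s ^ 2 = q) (δ : ℂ) (hδ : δ = -(q : ℂ) - (q : ℂ)⁻¹)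
    (z w : Fin 4 → ℂˣ) (hz : z = ![s, -s, s⁻¹, -s⁻¹]) (hw : ∀ i, w i = z i ^ 3) :
    (∀ i, AffineTL.Psi δ (Sum.inl (z i)) = AffineTL.Psi δ (Sum.inr (w i))) ∧
    Set.BijOn (AffineTL.Psi δ)
      (Sum.inl '' {x : ℂˣ | ∀ i, x ≠ z i} ∪ Sum.inr '' {x : ℂˣ | ∀ i, x ≠ w i})
      {P : AffineTL.V3 δ | ∀ i, P ≠ AffineTL.Psi δ (Sum.inl (z i))} := by
  have hg : AffineTL.GramFactors δ z := hz ▸ AffineTL.gramFactors hs hδ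
  have heq : ∀ i, AffineTL.Psi δ (Sum.inl (z i)) = AffineTL.Psi δ (Sum.inr (w i)) := by
    intro i
    rw [hw]
    exact AffineTL.Psi_inl_eq_inr ((AffineTL.evalAt_gram_eq_zero_iff hg _).2 ⟨i, rfl⟩)
  have hne : ∀ x : ℂˣ, (∀ i, x ≠ z i) → AffineTL.evalAt x (AffineTL.gram δ) ≠ 0 := by
    intro x hx h
    obtain ⟨i, hi⟩ := (AffineTL.evalAt_gram_eq_zero_iff hg x).1 h
    exact hx i hi
  refine ⟨heq, ?_, ?_, ?_⟩
  · rintro _ (⟨x, hx, rfl⟩ | ⟨x, hx, rfl⟩) i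
    · exact AffineTL.Psi_inl_ne_inl (hne x hx) (hx i)
    · rw [heq]
      exact AffineTL.Psi_inr_ne_inr hg hw hx (hx i)
  · rintro _ (⟨x, hx, rfl⟩ | ⟨x, hx, rfl⟩) _ (⟨y, hy, rfl⟩ | ⟨y, hy, rfl⟩) h
    · by_contra hxy
      exact AffineTL.Psi_inl_ne_inl (hne x hx) (fun e => hxy (congrArg _ e)) h
    · exact absurd h (AffineTL.Psi_inl_ne_inr (hne x hx) y)
    · exact absurd h.symm (AffineTL.Psi_inl_ne_inr (hne y hy) x)
    · by_contra hxy
      exact AffineTL.Psi_inr_ne_inr hg hw hx (fun e => hxy (congrArg _ e)) h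
  · intro P hP
    -- Any preimage lies in the restricted domain: were it some `z_i` or `w_i`, then `P` would be
    -- `Ψ(z_i) = Ψ(w_i)`.
    obtain ⟨x | x, rfl⟩ := AffineTL.Psi_surjective hg hw P
    · exact ⟨_, Or.inl ⟨x, fun i e => hP i (congrArg _ (congrArg _ e)), rfl⟩, rfl⟩
    · refine ⟨_, Or.inr ⟨x, fun i e => hP i ?_, rfl⟩, rfl⟩
      rw [heq, e]
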